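/- Let $D\subset\mathbb R^4$ be open and let $F:D\to\mathbb R$ be smooth ($C^\infty$). Consider the third-order ordinary differential equation $$y'''=F(x,y,y',y''),$$ where a solution on an open interval $I$ is a $C^3$ function $y:I\to\mathbb R$ with $(x,y(x),y'(x),y''(x))\in D$ for all $x\in I$. **Solution spaces and incidence.** A *regular solution space* of the equation (in local coordinates $P=(p_1,p_2,p_3)$) consists of a nonempty open interval $I$, an open set $M\subset\mathbb R^3$, and a smooth function $f$ on $I\times M$ such that for each $P\in M$ the function $x\mapsto f(x;P)$ is a solution on $I$, and the Wronskian determinant with rows $\big(\frac{\partial f}{\partial p_j}\big)_j,\ \big(\frac{\partial f_x}{\partial p_j}\big)_j,\ \big(\frac{\partial f_{xx}}{\partial p_j}\big)_j$ vanishes nowhere on $I\times M$. Given an open interval $J\subset I$ and an open set $W\subset M$, call $P,Q\in W$ *incident at* $x\in J$ if their 1-jets at $x$ agree: $$f(x;P)=f(x;Q),\qquad f_x(x;P)=f_x(x;Q),$$ and *incident* if they are incident at some $x\in J$. For $P\in W$ let $N_P\subset W$ be the set of all $Q\in W$ incident with $P$ (so $P\in N_P$), and for $Q\in N_P\setminus\{P\}$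 let $N_{PQ}$ be the set of all $R\in W$ such that, at some $x\in J$, both $Q$ and $R$ are incident with $P$. **Causal geometry.** These data form a causal geometry on $W$ if the following five axioms hold for every $P\in W$. 1. $N_P\setminus\{P\}$ is a smooth embedded hypersurface. 2. $N_P$ is ruled by the pencil of curves $N_{PQ}$: for each $Q\in N_P\setminus\{P\}$ the set $N_{PQ}$ is a smooth embedded curve (the image of an open interval under a smooth embedding) containing $P$ and $Q$; $N_P$ is the union of the curves $N_{PQ}$, $Q\in N_P\setminus\{P\}$; and two such curves $N_{PQ}$, $N_{PQ'}$ either coincide or meet only at $P$. 3. $N_{PQ}=N_{QP}$ for every $Q\in N_P\setminus\{P\}$. 4. The indicatrix $C_P\subset\mathbb P(T_PW)$, that is, the set of the tangent directions at $P$ of the curves $N_{PQ}$, $Q\in N_P\setminus\{P\}$, is a regular smooth embedded curve in the projective plane $\mathbb P(T_PW)$ which nowhere has second-order contact with its tangent line. 5. (Envelope condition.) If $Q,R\in N_P\setminus\{P\}$ are distinct and incident with each other, then $T_RN_P=T_RN_Q$. **Theorem.** (a) For every $(x_0,P_0)\in D$, with $P_0\in\mathbb R^3$, there is a regular solution space $(I,M,f)$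 with $x_0\in I$ and $P_0\in M$ such that, for each $P\in M$, the function $f(\cdot\,;P)$ is the unique solution on $I$ with $(y,y',y'')(x_0)=P$. (b) Let $(I,M,f)$ be any regular solution space, $x_0\in I$, $P_0\in M$. Then there exist arbitrarily small open intervals $J\ni x_0$ in $I$ and open neighbourhoods $W\subset M$ of $P_0$ such that two distinct solutions in $W$ are incident at no more than one point of $J$, and such that the sets $N_P$ and $N_{PQ}$ defined by the incidence relation form a causal geometry on $W$, i.e. Axioms 1–5 hold. -/

import Mathlib

open Set Topology
open scoped ContDiff LinearAlgebra.Projectivization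

/-- The model `ℝ³` for local coordinates on a three-dimensional solution space. -/
abbrev E3 : Type := EuclideanSpace ℝ (Fin 3)

/-- The quotient topology on the real projective plane `ℙ ℝ E3`. -/
noncomputable instance projectivePlaneTopology : TopologicalSpace (ℙ ℝ E3) :=
  TopologicalSpace.coinduced (Projectivization.mk' ℝ) inferInstance

/-! ### Elementary differential geometry of subsets of `ℝ³` -/

/-- `T` is a nonempty open interval of the real line (possibly unbounded). -/
def IsOpenInterval (T : Set ℝ) : Prop :=
  IsOpen T ∧ T.OrdConnected ∧ T.Nonempty

/-- `S` is a smooth embedded hypersurface (without boundary, not necessarily closed): near each of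
its points it is the zero set of a smooth function with nowhere vanishing differential. -/
def IsEmbeddedHypersurface (S : Set E3) : Prop :=
  ∀ Q ∈ S, ∃ V : Set E3, IsOpen V ∧ Q ∈ V ∧ ∃ g : E3 → ℝ,
    ContDiffOn ℝ ∞ g V ∧ (∀ R ∈ V, fderiv ℝ g R ≠ 0) ∧ S ∩ V = {R ∈ V | g R = 0}

/-- `S` is a smooth embedded (connected) curve: the image of an open interval under a smooth
immersion that is a homeomorphism onto its image. -/
def IsEmbeddedCurve (S : Set E3) : Prop :=
  ∃ (T : Set ℝ) (γ : ℝ → E3), IsOpenInterval T ∧ ContDiffOn ℝ ∞ γ T ∧ (∀ t ∈ T, deriv γ t ≠ 0) ∧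
    IsEmbedding (T.domRestrict γ) ∧ γ '' T = S

/-- The vectors tangent to `S` at `R`: the velocities at time `0` of the smooth curves in `S` that
are at `R` at time `0`. For an embedded submanifold `S` and `R ∈ S` this is the tangent space. -/
def tangentVectors (S : Set E3) (R : E3) : Set E3 :=
  {v | ∃ (ε : ℝ) (γ : ℝ → E3), 0 < ε ∧ ContDiffOn ℝ ∞ γ (Ioo (-ε) ε) ∧
    (∀ t ∈ Ioo (-ε) ε, γ t ∈ S) ∧ γ 0 = R ∧ deriv γ 0 = v}

/-- `C` is a regular smooth embedded curve in the projective plane that nowhere has second order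
contact with its tangent line. It is described by a lift `γ` to `ℝ³ \ {0}`: regularity at `t` says
that `γ t` and `γ' t` are independent; the tangent line at `t` is the projectivization of
`span {γ t, γ' t}`, and the contact with it is of second order iff `γ'' t` lies in this plane.
Neither condition depends on the choice of the lift or of the parameter. -/
def IsRegularCurveWithoutSecondOrderContact (C : Set (ℙ ℝ E3)) : Prop :=
  ∃ (T : Set ℝ) (γ : ℝ → E3) (hγ : ∀ t ∈ T, γ t ≠ 0),
    IsOpenInterval T ∧ ContDiffOn ℝ ∞ γ T ∧
    IsEmbedding (fun t : T => Projectivization.mk ℝ (γ t) (hγ t t.2)) ∧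
    Set.range (fun t : T => Projectivization.mk ℝ (γ t) (hγ t t.2)) = C ∧
    (∀ t ∈ T, LinearIndependent ℝ ![γ t, deriv γ t]) ∧
    (∀ t ∈ T, iteratedDeriv 2 γ t ∉ Submodule.span ℝ {γ t, deriv γ t})

/-! ### Causal geometries -/

/-- The indicatrix at `P`: the set of tangent directions at `P` of the curves `K P Q`, as `Q` varies
over `N P \ {P}`. -/
def indicatrix (N : E3 → Set E3) (K : E3 → E3 → Set E3) (P : E3) : Set (ℙ ℝ E3) :=
  {ℓ | ∃ Q ∈ N P \ {P}, ∃ (v : E3) (hv : v ≠ 0),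
    v ∈ tangentVectors (K P Q) P ∧ ℓ = Projectivization.mk ℝ v hv}

/-- The cones `N P` and the curves `K P Q` (for `Q ∈ N P \ {P}`) form a causal geometry on the open
set `W` of `ℝ³`. -/
structure IsCausalGeometry (W : Set E3) (N : E3 → Set E3) (K : E3 → E3 → Set E3) : Prop where
  isOpen : IsOpen W
  cone_subset : ∀ P ∈ W, N P ⊆ W
  vertex_mem : ∀ P ∈ W, P ∈ N P
  /-- Axiom 1: `N P \ {P}` is a smooth embedded hypersurface. -/
  axiom_one : ∀ P ∈ W, IsEmbeddedHypersurface (N P \ {P})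
  /-- Axiom 2: `N P` is ruled by a pencil of smooth curves `K P Q` through `P` and `Q`; two
  different curves of the pencil meet only at `P`. -/
  axiom_two : ∀ P ∈ W,
    (∀ Q ∈ N P \ {P}, IsEmbeddedCurve (K P Q) ∧ P ∈ K P Q ∧ Q ∈ K P Q) ∧
    N P = ⋃ Q ∈ N P \ {P}, K P Q ∧
    (∀ Q ∈ N P \ {P}, ∀ Q' ∈ N P \ {P}, K P Q = K P Q' ∨ K P Q ∩ K P Q' = {P})
  /-- Axiom 3: symmetry. -/
  axiom_three : ∀ P ∈ W, ∀ Q ∈ N P \ {P}, K P Q = K Q P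
  /-- Axiom 4: nondegeneracy of the indicatrix. -/
  axiom_four : ∀ P ∈ W, IsRegularCurveWithoutSecondOrderContact (indicatrix N K P)
  /-- Axiom 5: the envelope condition. -/
  axiom_five : ∀ P ∈ W, ∀ Q ∈ N P \ {P}, ∀ R ∈ N P \ {P}, Q ≠ R → R ∈ N Q → Q ∈ N R →
    tangentVectors (N P) R = tangentVectors (N Q) R

/-! ### Third-order equations and their solution spaces -/

/-- The 2-jet `(x, y, y', y'')` of a function at `x`. -/
noncomputable def jetTwo (y : ℝ → ℝ) (x : ℝ) : ℝ × ℝ × ℝ × ℝ :=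
  (x, y x, deriv y x, iteratedDeriv 2 y x)

/-- `y` solves `y''' = F (x, y, y', y'')` on the open interval `I`, where `F` is defined on `D`. -/
def IsSolutionOn (D : Set (ℝ × ℝ × ℝ × ℝ)) (F : ℝ × ℝ × ℝ × ℝ → ℝ) (I : Set ℝ) (y : ℝ → ℝ) :
    Prop :=
  ContDiffOn ℝ 3 y I ∧ ∀ x ∈ I, jetTwo y x ∈ D ∧ iteratedDeriv 3 y x = F (jetTwo y x)

/-- The matrix with rows `∂f/∂pⱼ`, `∂fₓ/∂pⱼ`, `∂fₓₓ/∂pⱼ` at `(x, P)`. -/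
noncomputable def wronskianMatrix (f : ℝ → E3 → ℝ) (x : ℝ) (P : E3) : Matrix (Fin 3) (Fin 3) ℝ :=
  Matrix.of fun k j =>
    fderiv ℝ (fun R : E3 => iteratedDeriv (k : ℕ) (fun t => f t R) x) P
      (EuclideanSpace.single j 1)

/-- The open set `M` of `ℝ³` is a coordinate domain of a solution space: `P ∈ M` represents the
solution `x ↦ f x P` on `I`, the dependence on `x` and `P` is smooth, and the Wronskian determinant
does not vanish. -/
structure IsRegularSolutionSpace (D : Set (ℝ × ℝ × ℝ × ℝ)) (F : ℝ × ℝ × ℝ × ℝ → ℝ) (I : Set ℝ)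
    (M : Set E3) (f : ℝ → E3 → ℝ) : Prop where
  isOpenInterval : IsOpenInterval I
  isOpen : IsOpen M
  smooth : ContDiffOn ℝ ∞ (fun z : ℝ × E3 => f z.1 z.2) (I ×ˢ M)
  isSolutionOn : ∀ P ∈ M, IsSolutionOn D F I (fun x => f x P)
  wronskian_ne_zero : ∀ x ∈ I, ∀ P ∈ M, (wronskianMatrix f x P).det ≠ 0

/-- The solutions `P` and `Q` are incident at `x`: their 1-jets at `x` agree. -/
def IncidentAt (f : ℝ → E3 → ℝ) (x : ℝ) (P Q : E3) : Prop :=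
  f x P = f x Q ∧ deriv (fun t => f t P) x = deriv (fun t => f t Q) x

/-- The solutions `P` and `Q`, regarded as functions on `J`, are incident. -/
def Incident (J : Set ℝ) (f : ℝ → E3 → ℝ) (P Q : E3) : Prop :=
  ∃ x ∈ J, IncidentAt f x P Q

/-- `N_P`: the solutions in `W` that are incident with `P`. -/
def incidenceCone (J : Set ℝ) (W : Set E3) (f : ℝ → E3 → ℝ) (P : E3) : Set E3 :=
  {Q ∈ W | Incident J f P Q}

/-- `N_PQ`: the solutions in `W` that are incident with `P` at the same point of the 1-jet space as
`Q`. -/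
def incidenceCurve (J : Set ℝ) (W : Set E3) (f : ℝ → E3 → ℝ) (P Q : E3) : Set E3 :=
  {R ∈ W | ∃ x ∈ J, IncidentAt f x P Q ∧ IncidentAt f x P R}

/-! For (a), the equation is the flow of `jetField F` on 2-jets. `exists_contDiffOn_flow` gives a
flow smooth in time and initial value jointly, by the inverse function theorem on a Banach space of
continuous paths. With initial data as coordinates the Wronskian matrix at the initial point is the
identity, so its determinant is nonzero nearby.

For (b), the Wronskian makes `(x, P) ↦ (x, f, f_x, f_xx)` a local diffeomorphism. On a small
interval times a small ball more holds: the parameter differentials of `f`, `f_x`, `f_xx`, taken at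
three unrelated points, have no common kernel. By the mean value theorem, two solutions whose values
agree at one point, first derivatives at a second and second derivatives at a third are equal
(`eq_of_famJet_eq`). Hence distinct solutions are incident at most once, and the difference of two
incident ones has one strict sign away from the incidence point. Comparing signs, three pairwise
incident solutions meet at a common `x` (`eq_of_pairwise_incidentAt`).

Near `Q ≠ P` the cone of `P` is the envelope, over `x`, of the surfaces `f(x; R) = f(x; P)`. Its
tangent plane at `Q` is the kernel of the parameter differential of `f` at the incidence point,
which yields the envelope condition. The curves of the pencil are level sets of `(f, f_x)` at fixed
`x`, parametrized by `f_xx`; they stay connected in the ball because the squared distance to its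
centre is convex along them. Their directions `w(x)` are killed by the differentials of `f` and
`f_x`; differentiating these relations in `x` gives the nondegeneracy of the indicatrix. -/

/-! ### Local inverses and tangent spaces of zero sets -/

theorem exists_openPartialHomeomorph_of_contDiffOn {X Y : Type*}
    [NormedAddCommGroup X] [NormedSpace ℝ X] [CompleteSpace X]
    [NormedAddCommGroup Y] [NormedSpace ℝ Y] {h : X → Y} {Ω : Set X} (hΩ : IsOpen Ω)
    (hh : ContDiffOn ℝ ∞ h Ω) {a : X} (ha : a ∈ Ω) (e : X ≃L[ℝ] Y)
    (he : HasFDerivAt h (e : X →L[ℝ] Y) a) :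
    ∃ Φ : OpenPartialHomeomorph X Y, (∀ x, Φ x = h x) ∧ a ∈ Φ.source ∧ Φ.source ⊆ Ω ∧
      ContDiffOn ℝ ∞ Φ.symm Φ.target := by
  have hat : ∀ x ∈ Ω, ContDiffAt ℝ ∞ h x := fun x hx => hh.contDiffAt (hΩ.mem_nhds hx)
  -- Restricting the source to points with invertible differential makes the inverse smooth on the
  -- whole target, not only at the image of `a`.
  set U : Set X := Ω ∩ fderiv ℝ h ⁻¹' range ((↑) : (X ≃L[ℝ] Y) → X →L[ℝ] Y) with hU
  have hUo : IsOpen U :=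
    (hh.continuousOn_fderiv_of_isOpen hΩ (by simp)).isOpen_inter_preimage hΩ
      ContinuousLinearEquiv.isOpen
  set Φ₀ := (hat a ha).toOpenPartialHomeomorph h he (by simp) with hΦ₀
  have hcoe : ∀ x, Φ₀ x = h x := fun x => rfl
  refine ⟨Φ₀.restrOpen U hUo, fun x => rfl, ?_, ?_, ?_⟩
  · refine ⟨(hat a ha).mem_toOpenPartialHomeomorph_source he (by simp), ha, ?_⟩
    exact ⟨e, he.fderiv.symm⟩
  · intro x hx
    exact hx.2.1
  · intro y hy
    have hs := (Φ₀.restrOpen U hUo).map_target hy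
    obtain ⟨e', he'⟩ := hs.2.2
    have hx := hs.2.1
    refine ((Φ₀.restrOpen U hUo).contDiffAt_symm hy (f₀' := e') ?_ (hat _ hx)).contDiffWithinAt
    rw [he']
    exact ((hat _ hx).differentiableAt (by simp)).hasFDerivAt

/-- The tangent vectors of the zero set of a submersion are the kernel of its differential. -/
theorem tangentVectors_eq_ker {S V : Set E3} {Q : E3} {g : E3 → ℝ} (hV : IsOpen V) (hQ : Q ∈ V)
    (hg : ContDiffOn ℝ ∞ g V) (hd : fderiv ℝ g Q ≠ 0) (hS : S ∩ V = {R ∈ V | g R = 0})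
    (hQS : Q ∈ S) : tangentVectors S Q = {v | fderiv ℝ g Q v = 0} := by
  have hgQ : HasFDerivAt g (fderiv ℝ g Q) Q :=
    ((hg.contDiffAt (hV.mem_nhds hQ)).differentiableAt (by simp)).hasFDerivAt
  have hQ0 : g Q = 0 := by
    have : Q ∈ S ∩ V := ⟨hQS, hQ⟩
    rw [hS] at this
    exact this.2
  ext v
  constructor
  · rintro ⟨ε, γ, hε, hγ, hγS, h0, rfl⟩
    have hIoo : Ioo (-ε) ε ∈ 𝓝 (0 : ℝ) := Ioo_mem_nhds (by linarith) hε
    have hγd : HasDerivAt γ (deriv γ 0) 0 :=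
      ((hγ.contDiffAt hIoo).differentiableAt (by simp)).hasDerivAt
    have h1 : HasDerivAt (g ∘ γ) (fderiv ℝ g Q (deriv γ 0)) 0 := by
      refine HasFDerivAt.comp_hasDerivAt (0 : ℝ) ?_ hγd
      rwa [h0]
    have h2 : g ∘ γ =ᶠ[𝓝 0] fun _ => 0 := by
      have hmem : ∀ᶠ t in 𝓝 (0 : ℝ), γ t ∈ V :=
        hγd.continuousAt.eventually (by rw [h0]; exact hV.mem_nhds hQ)
      filter_upwards [hIoo, hmem] with t ht htV
      have : γ t ∈ S ∩ V := ⟨hγS t ht, htV⟩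
      rw [hS] at this
      exact this.2
    exact h1.unique ((hasDerivAt_const (0 : ℝ) (0 : ℝ)).congr_of_eventuallyEq h2)
  · intro hv
    obtain ⟨e, he⟩ : ∃ e, fderiv ℝ g Q e = 1 := by
      obtain ⟨e, he⟩ : ∃ e, fderiv ℝ g Q e ≠ 0 := by
        by_contra! hcon
        exact hd (ContinuousLinearMap.ext hcon)
      exact ⟨(fderiv ℝ g Q e)⁻¹ • e, by simp [he]⟩
    set L := fderiv ℝ g Q with hL
    -- `H` straightens `S`: its differential at `Q` is the identity, and `L ∘ H = g` because `L e =
    -- 1`. The inverse image of the line `t • v` in the kernel of `L` is thus a curve in `S` with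
    -- velocity `v`.
    let H : E3 → E3 := fun X => (X - Q) + (g X - L (X - Q)) • e
    have hH : ContDiffOn ℝ ∞ H V := by
      have h1 : ContDiffOn ℝ ∞ (fun X : E3 => X - Q) V := (contDiff_id.sub contDiff_const).contDiffOn
      exact h1.add ((hg.sub (L.contDiff.comp_contDiffOn h1)).smul contDiffOn_const)
    have hHd : HasFDerivAt H ((ContinuousLinearEquiv.refl ℝ E3 : E3 ≃L[ℝ] E3) : E3 →L[ℝ] E3) Q := by
      have h1 : HasFDerivAt (fun X : E3 => X - Q) (ContinuousLinearMap.id ℝ E3) Q :=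
        (hasFDerivAt_id Q).sub_const Q
      have h2 := h1.add ((hgQ.sub (L.hasFDerivAt.comp Q h1)).smul_const e)
      refine h2.congr_fderiv ?_
      ext v
      simp
    obtain ⟨Φ, hΦ, hQΦ, hΦV, hsymm⟩ := exists_openPartialHomeomorph_of_contDiffOn hV hH hQ _ hHd
    have hH0 : Φ Q = 0 := by simp [hΦ, H, hQ0]
    have hLH : ∀ X, L (H X) = g X := by
      intro X
      simp [H, he]
    have h0t : (0 : E3) ∈ Φ.target := hH0 ▸ Φ.map_source hQΦ
    obtain ⟨ε, hε, hball⟩ : ∃ ε > (0 : ℝ), ∀ t ∈ Ioo (-ε) ε, t • v ∈ Φ.target := by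
      have hc : ContinuousAt (fun t : ℝ => t • v) 0 := by fun_prop
      have : ∀ᶠ t in 𝓝 (0 : ℝ), t • v ∈ Φ.target :=
        hc.eventually (by simpa using Φ.open_target.mem_nhds h0t)
      obtain ⟨ε, hε, h⟩ := Metric.eventually_nhds_iff.1 this
      refine ⟨ε, hε, fun t ht => h ?_⟩
      simpa [abs_lt] using ht
    have hγ : ContDiffOn ℝ ∞ (fun t : ℝ => Φ.symm (t • v)) (Ioo (-ε) ε) :=
      hsymm.comp (contDiff_id.smul contDiff_const).contDiffOn hball
    have hγ0 : Φ.symm ((0 : ℝ) • v) = Q := by rw [zero_smul, ← hH0, Φ.left_inv hQΦ]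
    refine ⟨ε, fun t => Φ.symm (t • v), hε, hγ, ?_, hγ0, ?_⟩
    · intro t ht
      have hs := Φ.map_target (hball t ht)
      have : Φ.symm (t • v) ∈ S ∩ V := by
        rw [hS]
        refine ⟨hΦV hs, ?_⟩
        rw [← hLH, ← hΦ, Φ.right_inv (hball t ht), map_smul, show L v = 0 from hv, smul_zero]
      exact this.1
    · have hIoo : Ioo (-ε) ε ∈ 𝓝 (0 : ℝ) := Ioo_mem_nhds (by linarith) hε
      have hγd : HasDerivAt (fun t : ℝ => Φ.symm (t • v)) _ 0 :=
        ((hγ.contDiffAt hIoo).differentiableAt (by simp)).hasDerivAt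
      have h1 : HasDerivAt (H ∘ fun t : ℝ => Φ.symm (t • v))
          (deriv (fun t : ℝ => Φ.symm (t • v)) 0) 0 := by
        have := HasFDerivAt.comp_hasDerivAt (0 : ℝ) (by rw [hγ0]; exact hHd) hγd
        simpa using this
      have h2 : (H ∘ fun t : ℝ => Φ.symm (t • v)) =ᶠ[𝓝 0] fun t => t • v := by
        filter_upwards [hIoo] with t ht
        simp only [Function.comp, ← hΦ]
        exact Φ.right_inv (hball t ht)
      have h3 : HasDerivAt (fun t : ℝ => t • v) v 0 := by
        simpa using (hasDerivAt_id (0 : ℝ)).smul_const v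
      exact h1.unique (h3.congr_of_eventuallyEq h2)

/-! ### Superposition operators on spaces of continuous functions -/

universe u

section Superposition

variable {K : Type*} [TopologicalSpace K] [CompactSpace K]
  {E F : Type u} [NormedAddCommGroup E] [NormedSpace ℝ E] [NormedAddCommGroup F] [NormedSpace ℝ F]

/-- Pointwise application of a continuous family of operators to a continuous function. -/
noncomputable def pointwiseApply :
    C(K, E →L[ℝ] F) →L[ℝ] C(K, E) →L[ℝ] C(K, F) :=
  LinearMap.mkContinuous₂
    (LinearMap.mk₂ ℝ
      (fun (A : C(K, E →L[ℝ] F)) (h : C(K, E)) =>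
        (⟨fun t => A t (h t), A.continuous.clm_apply h.continuous⟩ : C(K, F)))
      (fun A B h => by ext t; simp) (fun c A h => by ext t; simp)
      (fun A h k => by ext t; simp) (fun c A h => by ext t; simp)) 1
    (fun A h => by
      rw [one_mul]
      refine (ContinuousMap.norm_le _ (by positivity)).2 fun t => ?_
      exact (A t).le_opNorm_of_le (h.norm_coe_le_norm t) |>.trans
        (mul_le_mul_of_nonneg_right (A.norm_coe_le_norm t) (norm_nonneg _)))

theorem pointwiseApply_apply (A : C(K, E →L[ℝ] F)) (h : C(K, E)) (t : K) :
    pointwiseApply A h t = A t (h t) := rfl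

/-- Since `w ↦ V'.comp w` is continuous in the sup norm, the mean value estimate at `w t` is uniform
in `t`. -/
theorem hasFDerivAt_continuousMap_comp (V : C(E, F)) (V' : C(E, E →L[ℝ] F))
    (hV : ∀ x, HasFDerivAt V (V' x) x) (w : C(K, E)) :
    HasFDerivAt (fun w : C(K, E) => V.comp w) (pointwiseApply (V'.comp w)) w := by
  rw [hasFDerivAt_iff_isLittleO_nhds_zero, Asymptotics.isLittleO_iff]
  intro ε hε
  have hc : Continuous fun w : C(K, E) => V'.comp w := ContinuousMap.continuous_postcomp V'
  obtain ⟨δ, hδ, hball⟩ := (Metric.continuous_iff (α := C(K, E)) (β := C(K, E →L[ℝ] F))).1 hc w ε hε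
  filter_upwards [Metric.ball_mem_nhds (0 : C(K, E)) hδ] with h hh
  refine (ContinuousMap.norm_le _ (by positivity)).2 fun t => ?_
  have hht : ‖h t‖ < δ := (h.norm_coe_le_norm t).trans_lt (by simpa using hh)
  have key := (convex_ball (w t) δ).norm_image_sub_le_of_norm_hasFDerivWithin_le'
    (f := V) (f' := V') (φ := V' (w t)) (C := ε) (x := w t) (y := w t + h t)
    (fun x _ => (hV x).hasFDerivWithinAt) ?_ (Metric.mem_ball_self hδ) (by simpa using hht)
  · have hle : ε * ‖w t + h t - w t‖ ≤ ε * ‖h‖ := by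
      rw [add_sub_cancel_left]
      exact mul_le_mul_of_nonneg_left (h.norm_coe_le_norm t) hε.le
    simpa [pointwiseApply_apply] using key.trans hle
  · intro x hx
    -- The constant shift of `w` by `x - w t` takes the value `x` at `t`, which turns closeness in
    -- the sup norm into closeness of `V' x` and `V' (w t)`.
    have hd : dist (w + ContinuousMap.const K (x - w t)) w < δ := by
      rw [dist_eq_norm, add_sub_cancel_left]
      refine ((ContinuousMap.norm_le _ (norm_nonneg (x - w t))).2 fun s => le_rfl).trans_lt ?_
      rwa [← dist_eq_norm]
    have h1 := (ContinuousMap.dist_apply_le_dist t).trans (hball _ hd).le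
    simpa [dist_eq_norm] using h1

/-- The derivative is again a superposition operator, with values in `E →L[ℝ] F`, followed by a
fixed linear map; so the induction must allow `F` to change, within one universe. -/
theorem contDiff_nat_continuousMap_comp (n : ℕ) :
    ∀ {F : Type u} [NormedAddCommGroup F] [NormedSpace ℝ F] (V : C(E, F)),
      ContDiff ℝ n V → ContDiff ℝ n (fun w : C(K, E) => V.comp w) := by
  induction n with
  | zero =>
    intro F _ _ V _
    exact contDiff_zero.2 (ContinuousMap.continuous_postcomp V)
  | succ n ih =>
    intro F _ _ V hV
    obtain ⟨V', hV', hd⟩ := contDiff_succ_iff_hasFDerivAt.1 hV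
    let W : C(E, E →L[ℝ] F) := ⟨V', hV'.continuous⟩
    have hA : ContDiff ℝ n (pointwiseApply (K := K) (E := E) (F := F)) :=
      ContinuousLinearMap.contDiff _
    exact contDiff_succ_iff_hasFDerivAt.2 ⟨fun w => pointwiseApply (W.comp w),
      hA.comp (ih W hV'), hasFDerivAt_continuousMap_comp V W hd⟩

theorem contDiff_continuousMap_comp (V : C(E, F)) (hV : ContDiff ℝ ∞ V) :
    ContDiff ℝ ∞ (fun w : C(K, E) => V.comp w) :=
  contDiff_infty.2 fun n =>
    contDiff_nat_continuousMap_comp n V (hV.of_le (mod_cast le_top))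

/-- The constant functions, as a continuous linear map. -/
noncomputable def constCLM : E →L[ℝ] C(K, E) :=
  LinearMap.mkContinuous
    { toFun := ContinuousMap.const K
      map_add' := fun _ _ => rfl
      map_smul' := fun _ _ => rfl } 1
    (fun x => by
      rw [one_mul]
      exact (ContinuousMap.norm_le _ (norm_nonneg _)).2 fun t => le_rfl)

theorem eq_add_smul_of_sub_eq_zero {w v : C(K, E)} {p : E} {s : ℝ}
    (h : w - constCLM p - s • v = 0) (t : K) : w t = p + s • v t := by
  have h' : w = constCLM p + s • v := by rwa [sub_sub, sub_eq_zero] at h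
  rw [h']
  rfl

end Superposition

/-! ### Smooth dependence of the flow on time and initial value -/

section Flow

variable {E : Type u} [NormedAddCommGroup E] [NormedSpace ℝ E]

/-- The primitive vanishing at `0` of a continuous function on the unit interval. -/
noncomputable def primitiveCLM : C(unitInterval, E) →L[ℝ] C(unitInterval, E) :=
  LinearMap.mkContinuous
    { toFun := fun w => ⟨fun t => ∫ τ in (0 : ℝ)..t, IccExtend zero_le_one w τ,
        (intervalIntegral.continuous_primitive
          (fun a b => (w.continuous.Icc_extend' (h := zero_le_one)).intervalIntegrable a b) 0).comp
          continuous_subtype_val⟩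
      map_add' := fun v w => by
        ext t
        exact intervalIntegral.integral_add
          ((v.continuous.Icc_extend' (h := zero_le_one)).intervalIntegrable _ _)
          ((w.continuous.Icc_extend' (h := zero_le_one)).intervalIntegrable _ _)
      map_smul' := fun c w => by
        ext t
        exact intervalIntegral.integral_smul c (IccExtend zero_le_one w) } 1
    (fun w => by
      rw [one_mul]
      refine (ContinuousMap.norm_le _ (norm_nonneg _)).2 fun t => ?_
      have h := intervalIntegral.norm_integral_le_of_norm_le_const (a := (0 : ℝ)) (b := t)
        (C := ‖w‖) (f := IccExtend zero_le_one w) (fun τ _ => w.norm_coe_le_norm _)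
      refine h.trans (mul_le_of_le_one_right (norm_nonneg _) ?_)
      rw [sub_zero, abs_of_nonneg t.2.1]
      exact t.2.2)

/-- A smooth vector field has a local flow that is smooth in time and initial value together. -/
theorem exists_contDiffOn_flow [CompleteSpace E] {V : E → E} (hV : ContDiff ℝ ∞ V) (p₀ : E) :
    ∃ (ε : ℝ) (φ : ℝ × E → E), 0 < ε ∧
      ContDiffOn ℝ ∞ φ (Ioo (-ε) ε ×ˢ Metric.ball p₀ ε) ∧
      (∀ p ∈ Metric.ball p₀ ε, φ (0, p) = p) ∧
      ∀ s ∈ Ioo (-ε) ε, ∀ p ∈ Metric.ball p₀ ε,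
        HasDerivAt (fun s => φ (s, p)) (V (φ (s, p))) s := by
  let X := C(unitInterval, E)
  let VC : C(E, E) := ⟨V, hV.continuous⟩
  let N : X → X := fun w => primitiveCLM (VC.comp w)
  have hN : ContDiff ℝ ∞ N := by
    have hT : ContDiff ℝ ∞ (primitiveCLM (E := E)) := ContinuousLinearMap.contDiff _
    exact hT.comp (contDiff_continuousMap_comp VC hV)
  -- The last component vanishes iff `w(t) = p + s ∫₀ᵗ V(w)`, that is, `w` is the trajectory of `p`
  -- up to time `s` rescaled to the unit interval. Time has become a parameter on the same footing
  -- as `p`.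
  let H : ℝ × E × X → ℝ × E × X := fun z => (z.1, z.2.1, z.2.2 - constCLM z.2.1 - z.1 • N z.2.2)
  have hH : ContDiff ℝ ∞ H := by
    have h1 : ContDiff ℝ ∞ fun z : ℝ × E × X => z.1 := contDiff_fst
    have h2 : ContDiff ℝ ∞ fun z : ℝ × E × X => z.2.1 := contDiff_fst.comp contDiff_snd
    have h3 : ContDiff ℝ ∞ fun z : ℝ × E × X => z.2.2 := contDiff_snd.comp contDiff_snd
    have hc : ContDiff ℝ ∞ (constCLM (K := unitInterval) (E := E)) :=
      ContinuousLinearMap.contDiff _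
    have h4 : ContDiff ℝ ∞ fun z : ℝ × E × X => constCLM (K := unitInterval) z.2.1 := hc.comp h2
    have h5 : ContDiff ℝ ∞ fun z : ℝ × E × X => z.1 • N z.2.2 := h1.smul (hN.comp h3)
    exact h1.prodMk (h2.prodMk ((h3.sub h4).sub h5))
  let w₀ : X := constCLM p₀
  let a : ℝ × E × X := (0, p₀, w₀)
  let pr1 : ℝ × E × X →L[ℝ] ℝ := ContinuousLinearMap.fst ℝ ℝ (E × X)
  let pr2 : ℝ × E × X →L[ℝ] E :=
    (ContinuousLinearMap.fst ℝ E X).comp (ContinuousLinearMap.snd ℝ ℝ (E × X))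
  let pr3 : ℝ × E × X →L[ℝ] X :=
    (ContinuousLinearMap.snd ℝ E X).comp (ContinuousLinearMap.snd ℝ ℝ (E × X))
  let B : ℝ × E × X →L[ℝ] X := constCLM.comp pr2 + pr1.smulRight (N w₀)
  -- The derivative of `N` drops out at `s = 0`, so the differential is unipotent triangular and is
  -- inverted by changing the sign of `B`.
  let e : (ℝ × E × X) ≃L[ℝ] (ℝ × E × X) :=
    ContinuousLinearEquiv.equivOfInverse (pr1.prod (pr2.prod (pr3 - B)))
      (pr1.prod (pr2.prod (pr3 + B)))
      (fun z => by simp [pr1, pr2, pr3, B]) (fun z => by simp [pr1, pr2, pr3, B])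
  have he : HasFDerivAt H (e : (ℝ × E × X) →L[ℝ] (ℝ × E × X)) a := by
    have hpr1 : HasFDerivAt (fun z : ℝ × E × X => z.1) pr1 a := pr1.hasFDerivAt
    have hpr2 : HasFDerivAt (fun z : ℝ × E × X => z.2.1) pr2 a := pr2.hasFDerivAt
    have hpr3 : HasFDerivAt (fun z : ℝ × E × X => z.2.2) pr3 a := pr3.hasFDerivAt
    have hNd : HasFDerivAt N (fderiv ℝ N w₀) a.2.2 :=
      (hN.differentiable (by simp) w₀).hasFDerivAt
    have h3 := (hpr3.sub (constCLM.hasFDerivAt.comp a hpr2)).sub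
      (hpr1.smul (hNd.comp a hpr3))
    refine (hpr1.prodMk (hpr2.prodMk h3)).congr_fderiv ?_
    ext z <;> simp [e, B, a, pr1, pr2, pr3, sub_sub]
  obtain ⟨Φ, hΦ, haΦ, -, hsymm⟩ :=
    exists_openPartialHomeomorph_of_contDiffOn isOpen_univ hH.contDiffOn (mem_univ a) e he
  have hHa : H a = (0, p₀, 0) := by simp [H, a, w₀]
  have hat : ((0 : ℝ), p₀, (0 : X)) ∈ Φ.target := by
    rw [← hHa, ← hΦ]
    exact Φ.map_source haΦ
  have hsa : Φ.symm (0, p₀, 0) = a := by rw [← hHa, ← hΦ, Φ.left_inv haΦ]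
  -- A whole ball in the source is needed: the rescaled paths must lie where `Φ` is injective in
  -- order to be identified with `W`.
  obtain ⟨r, hr, hrball⟩ := Metric.isOpen_iff.1 Φ.open_source a haΦ
  have hj : Continuous fun z : ℝ × E => ((z.1, z.2, (0 : X)) : ℝ × E × X) := by fun_prop
  have hcont : ContinuousAt (fun z : ℝ × E => Φ.symm (z.1, z.2, 0)) (0, p₀) :=
    ContinuousAt.comp (f := fun z : ℝ × E => ((z.1, z.2, (0 : X)) : ℝ × E × X))
      (hsymm.continuousOn.continuousAt (Φ.open_target.mem_nhds hat)) hj.continuousAt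
  obtain ⟨ε, hε, hball⟩ : ∃ ε > (0 : ℝ), ∀ s ∈ Ioo (-ε) ε, ∀ p ∈ Metric.ball p₀ ε,
      (s, p, (0 : X)) ∈ Φ.target ∧ dist (Φ.symm (s, p, 0)) a < r := by
    have h1 : ∀ᶠ z in 𝓝 ((0 : ℝ), p₀), (z.1, z.2, (0 : X)) ∈ Φ.target :=
      hj.continuousAt.eventually (Φ.open_target.mem_nhds hat)
    have h2 : ∀ᶠ z in 𝓝 ((0 : ℝ), p₀), dist (Φ.symm (z.1, z.2, 0)) a < r := by
      have := Metric.tendsto_nhds.1 hcont r hr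
      simpa only [hsa] using this
    obtain ⟨ε, hε, h⟩ := Metric.eventually_nhds_iff.1 (h1.and h2)
    refine ⟨ε, hε, fun s hs p hp => h (y := (s, p)) ?_⟩
    rw [Prod.dist_eq]
    exact max_lt (by simpa [abs_lt] using hs) hp
  let W : ℝ → E → X := fun s p => (Φ.symm (s, p, 0)).2.2
  have hW : ∀ s ∈ Ioo (-ε) ε, ∀ p ∈ Metric.ball p₀ ε, Φ.symm (s, p, 0) = (s, p, W s p) ∧
      W s p - constCLM p - s • N (W s p) = 0 ∧ dist (W s p) w₀ < r := by
    intro s hs p hp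
    obtain ⟨h1, h2⟩ := hball s hs p hp
    have h3 : H (Φ.symm (s, p, 0)) = (s, p, 0) := by rw [← hΦ, Φ.right_inv h1]
    simp only [H, Prod.mk.injEq] at h3
    obtain ⟨e1, e2, e3⟩ := h3
    refine ⟨Prod.ext e1 (Prod.ext e2 rfl), ?_, ?_⟩
    · rw [e1, e2] at e3
      exact e3
    · rw [Prod.dist_eq, Prod.dist_eq] at h2
      exact (le_max_right _ _).trans_lt ((le_max_right _ _).trans_lt h2)
  have one_mem : (1 : ℝ) ∈ unitInterval := ⟨zero_le_one, le_rfl⟩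
  let φ : ℝ × E → E := fun z => W z.1 z.2 ⟨1, one_mem⟩
  have hscale : ∀ s ∈ Ioo (-ε) ε, ∀ p ∈ Metric.ball p₀ ε, ∀ t : unitInterval,
      W s p t = p + ∫ σ in (0 : ℝ)..s * t, V (φ (σ, p)) := by
    have hdist : ∀ p ∈ Metric.ball p₀ ε, dist p p₀ < r := by
      intro p hp
      have h := (hball 0 ⟨by linarith, hε⟩ p hp).2
      rw [(hW 0 ⟨by linarith, hε⟩ p hp).1, Prod.dist_eq, Prod.dist_eq] at h
      exact (le_max_left _ _).trans_lt ((le_max_right _ _).trans_lt h)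
    have hform : ∀ s ∈ Ioo (-ε) ε, ∀ p ∈ Metric.ball p₀ ε, ∀ t : unitInterval,
        W s p t = p + s • ∫ τ in (0 : ℝ)..t, V (IccExtend zero_le_one (W s p) τ) := by
      intro s hs p hp t
      exact eq_add_smul_of_sub_eq_zero (hW s hs p hp).2.1 t
    -- The path `τ ↦ W s p (t τ)` solves the fixed-point equation for the time `s t`, so it is `W (s
    -- t) p` by injectivity of `Φ`; evaluation at `τ = 1` gives the claim.
    have hrestrict : ∀ s ∈ Ioo (-ε) ε, ∀ p ∈ Metric.ball p₀ ε, ∀ t : unitInterval,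
        W s p t = φ (s * t, p) := by
      intro s hs p hp t
      have hst : s * t ∈ Ioo (-ε) ε := by
        have h1 : |s * t| < ε := by
          rw [abs_mul, abs_of_nonneg t.2.1]
          exact (mul_le_of_le_one_right (abs_nonneg s) t.2.2).trans_lt (abs_lt.2 hs)
        exact abs_lt.1 h1
      let w : X := ⟨fun τ => W s p (t * τ), by fun_prop⟩
      have hw : dist w w₀ < r := by
        refine (ContinuousMap.dist_lt_iff hr).2 fun τ => ?_
        exact (ContinuousMap.dist_apply_le_dist (f := W s p) (g := w₀) (t * τ)).trans_lt
          (hW s hs p hp).2.2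
      have hsr : |s * t| < r := by
        have h := (hball _ hst p hp).2
        rw [(hW _ hst p hp).1, Prod.dist_eq] at h
        have h' := (le_max_left _ _).trans_lt h
        simpa [a] using h'
      have hmem : ((s * t, p, w) : ℝ × E × X) ∈ Φ.source := by
        refine hrball ?_
        rw [Metric.mem_ball, Prod.dist_eq, Prod.dist_eq]
        exact max_lt (by simpa [a] using hsr) (max_lt (hdist p hp) hw)
      have hHw : H (s * t, p, w) = (s * t, p, 0) := by
        simp only [H, Prod.mk.injEq, true_and]
        rw [sub_sub, sub_eq_zero]
        ext τ
        have h1 := hform s hs p hp (t * τ)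
        have h2 : ∫ τ' in (0 : ℝ)..τ, V (IccExtend zero_le_one w τ') =
            ∫ τ' in (0 : ℝ)..τ, V (IccExtend zero_le_one (W s p) (t * τ')) := by
          refine intervalIntegral.integral_congr fun τ' hτ' => ?_
          rw [uIcc_of_le τ.2.1] at hτ'
          have m1 : τ' ∈ unitInterval := ⟨hτ'.1, hτ'.2.trans τ.2.2⟩
          have m2 : (t : ℝ) * τ' ∈ unitInterval := (t * ⟨τ', m1⟩ : unitInterval).2
          simp only [IccExtend_of_mem _ _ m1, IccExtend_of_mem _ _ m2]
          rfl
        have h3 : (w : unitInterval → E) τ = p + (s * t) •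
            ∫ τ' in (0 : ℝ)..τ, V (IccExtend zero_le_one w τ') := by
          rw [h2, mul_smul, intervalIntegral.smul_integral_comp_mul_left
            (f := fun x => V (IccExtend zero_le_one (W s p) x)), mul_zero]
          exact h1
        exact h3
      have h4 : Φ.symm (s * t, p, 0) = (s * t, p, w) := by
        rw [← hHw, ← hΦ, Φ.left_inv hmem]
      have h5 : W (s * t) p = w := congrArg (fun z => z.2.2) h4
      change W s p t = W (s * t) p ⟨1, one_mem⟩
      rw [h5]
      change W s p t = W s p (t * 1)
      rw [mul_one]
    intro s hs p hp t
    have h1 : ∫ τ in (0 : ℝ)..t, V (IccExtend zero_le_one (W s p) τ) =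
        ∫ τ in (0 : ℝ)..t, V (φ (s * τ, p)) := by
      refine intervalIntegral.integral_congr fun τ hτ => ?_
      rw [uIcc_of_le t.2.1] at hτ
      have m1 : τ ∈ unitInterval := ⟨hτ.1, hτ.2.trans t.2.2⟩
      simp only [IccExtend_of_mem _ _ m1]
      rw [hrestrict s hs p hp ⟨τ, m1⟩]
    rw [hform s hs p hp t, h1, intervalIntegral.smul_integral_comp_mul_left
      (f := fun x => V (φ (x, p))), mul_zero]
  have hφ : ContDiffOn ℝ ∞ φ (Ioo (-ε) ε ×ˢ Metric.ball p₀ ε) := by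
    have hj' : ContDiff ℝ ∞ fun z : ℝ × E => ((z.1, z.2, (0 : X)) : ℝ × E × X) :=
      contDiff_fst.prodMk (contDiff_snd.prodMk contDiff_const)
    have h1 : ContDiffOn ℝ ∞ (fun z : ℝ × E => Φ.symm (z.1, z.2, 0))
        (Ioo (-ε) ε ×ˢ Metric.ball p₀ ε) :=
      hsymm.comp hj'.contDiffOn fun z hz => (hball z.1 hz.1 z.2 hz.2).1
    exact (ContinuousMap.evalCLM ℝ (⟨1, one_mem⟩ : unitInterval)).contDiff.comp_contDiffOn
      h1.snd.snd
  have hint : ∀ s ∈ Ioo (-ε) ε, ∀ p ∈ Metric.ball p₀ ε,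
      φ (s, p) = p + ∫ σ in (0 : ℝ)..s, V (φ (σ, p)) := by
    intro s hs p hp
    have h := hscale s hs p hp ⟨1, one_mem⟩
    simpa only [mul_one] using h
  have h0ε : (0 : ℝ) ∈ Ioo (-ε) ε := ⟨by linarith, hε⟩
  refine ⟨ε, φ, hε, hφ, fun p hp => by simpa using hint 0 h0ε p hp, fun s hs p hp => ?_⟩
  have hc : ContinuousOn (fun σ => V (φ (σ, p))) (Ioo (-ε) ε) :=
    hV.continuous.comp_continuousOn
      (hφ.continuousOn.comp (by fun_prop) fun σ hσ => ⟨hσ, hp⟩)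
  have hsub : uIcc 0 s ⊆ Ioo (-ε) ε := ordConnected_Ioo.uIcc_subset h0ε hs
  have hd := intervalIntegral.integral_hasDerivAt_right
    ((hc.mono hsub).intervalIntegrable)
    (hc.stronglyMeasurableAtFilter isOpen_Ioo s hs) (hc.continuousAt (isOpen_Ioo.mem_nhds hs))
  refine (hd.const_add p).congr_of_eventuallyEq ?_
  filter_upwards [isOpen_Ioo.mem_nhds hs] with σ hσ using hint σ hσ p hp

end Flow

/-! ### Derivatives of components and along slices of a product -/

section Slices

variable {E F G : Type*} [NormedAddCommGroup E] [NormedSpace ℝ E] [NormedAddCommGroup F]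
  [NormedSpace ℝ F] [NormedAddCommGroup G] [NormedSpace ℝ G]

theorem HasDerivAt.prodFst {g : ℝ → E × F} {g' : E × F} {x : ℝ} (h : HasDerivAt g g' x) :
    HasDerivAt (fun t => (g t).1) g'.1 x :=
  (ContinuousLinearMap.fst ℝ E F).hasFDerivAt.comp_hasDerivAt x h

theorem HasDerivAt.prodSnd {g : ℝ → E × F} {g' : E × F} {x : ℝ} (h : HasDerivAt g g' x) :
    HasDerivAt (fun t => (g t).2) g'.2 x :=
  (ContinuousLinearMap.snd ℝ E F).hasFDerivAt.comp_hasDerivAt x h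

theorem HasFDerivAt.slice_left {g : ℝ × E → G} {L : ℝ × E →L[ℝ] G} {x : ℝ} {P : E}
    (h : HasFDerivAt g L (x, P)) : HasDerivAt (fun t => g (t, P)) (L (1, 0)) x := by
  have h3 : HasDerivAt (fun t : ℝ => (t, P)) ((1 : ℝ), (0 : E)) x :=
    (hasDerivAt_id x).prodMk (hasDerivAt_const x P)
  exact HasFDerivAt.comp_hasDerivAt (l := g) (f := fun t : ℝ => (t, P)) x h h3

theorem HasFDerivAt.slice_right {g : ℝ × E → G} {L : ℝ × E →L[ℝ] G} {x : ℝ} {P : E}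
    (h : HasFDerivAt g L (x, P)) :
    HasFDerivAt (fun R => g (x, R)) (L.comp (ContinuousLinearMap.inr ℝ ℝ E)) P :=
  HasFDerivAt.comp (g := g) (f := fun R : E => (x, R)) P h (hasFDerivAt_prodMk_right x P)

end Slices

/-! ### Jets of a family of functions -/

theorem IsOpenInterval.ioo {a b : ℝ} (h : a < b) : IsOpenInterval (Ioo a b) :=
  ⟨isOpen_Ioo, ordConnected_Ioo, nonempty_Ioo.2 h⟩

/-- The `k`-th derivative of the member `P` of a family of functions, as a function of `(x, P)`. -/
noncomputable def famJet (f : ℝ → E3 → ℝ) (k : ℕ) (z : ℝ × E3) : ℝ :=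
  iteratedDeriv k (fun t => f t z.2) z.1

/-- The differential of the `k`-th derivative with respect to the parameters. -/
noncomputable def famJetD (f : ℝ → E3 → ℝ) (k : ℕ) (z : ℝ × E3) : E3 →L[ℝ] ℝ :=
  fderiv ℝ (fun R => famJet f k (z.1, R)) z.2

section FamJet

variable {f : ℝ → E3 → ℝ} {I : Set ℝ} {M : Set E3}

theorem famJet_succ (k : ℕ) (x : ℝ) (P : E3) :
    famJet f (k + 1) (x, P) = deriv (fun t => famJet f k (t, P)) x := by
  simp only [famJet, iteratedDeriv_succ]

theorem contDiffOn_famJet (hI : IsOpen I) (hM : IsOpen M)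
    (hf : ContDiffOn ℝ ∞ (fun z : ℝ × E3 => f z.1 z.2) (I ×ˢ M)) (k : ℕ) :
    ContDiffOn ℝ ∞ (famJet f k) (I ×ˢ M) := by
  induction k with
  | zero => exact hf.congr fun z _ => by simp [famJet]
  | succ k ih =>
    have h1 : ContDiffOn ℝ ∞ (fun z => fderiv ℝ (famJet f k) z ((1 : ℝ), (0 : E3))) (I ×ˢ M) :=
      (ih.fderiv_of_isOpen (hI.prod hM) (by simp)).clm_apply contDiffOn_const
    refine h1.congr fun z hz => ?_
    have h2 : HasFDerivAt (famJet f k) (fderiv ℝ (famJet f k) z) z :=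
      ((ih.contDiffAt ((hI.prod hM).mem_nhds hz)).differentiableAt (by simp)).hasFDerivAt
    exact (famJet_succ k z.1 z.2).trans h2.slice_left.deriv

theorem hasDerivAt_famJet (hI : IsOpen I) (hM : IsOpen M)
    (hf : ContDiffOn ℝ ∞ (fun z : ℝ × E3 => f z.1 z.2) (I ×ˢ M)) (k : ℕ) {x : ℝ} {P : E3}
    (hx : x ∈ I) (hP : P ∈ M) :
    HasDerivAt (fun t => famJet f k (t, P)) (famJet f (k + 1) (x, P)) x := by
  rw [famJet_succ]
  have h := ((contDiffOn_famJet hI hM hf k).contDiffAt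
    ((hI.prod hM).mem_nhds (mk_mem_prod hx hP))).differentiableAt (by simp)
  exact (h.comp x (f := fun t : ℝ => (t, P)) (by fun_prop)).hasDerivAt

theorem famJetD_eq (hI : IsOpen I) (hM : IsOpen M)
    (hf : ContDiffOn ℝ ∞ (fun z : ℝ × E3 => f z.1 z.2) (I ×ˢ M)) (k : ℕ) {z : ℝ × E3}
    (hz : z ∈ I ×ˢ M) :
    famJetD f k z = (fderiv ℝ (famJet f k) z).comp (ContinuousLinearMap.inr ℝ ℝ E3) := by
  have h : HasFDerivAt (famJet f k) (fderiv ℝ (famJet f k) z) z :=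
    (((contDiffOn_famJet hI hM hf k).contDiffAt
      ((hI.prod hM).mem_nhds hz)).differentiableAt (by simp)).hasFDerivAt
  exact h.slice_right.fderiv

theorem contDiffOn_famJetD (hI : IsOpen I) (hM : IsOpen M)
    (hf : ContDiffOn ℝ ∞ (fun z : ℝ × E3 => f z.1 z.2) (I ×ˢ M)) (k : ℕ) :
    ContDiffOn ℝ ∞ (famJetD f k) (I ×ˢ M) :=
  (((contDiffOn_famJet hI hM hf k).fderiv_of_isOpen (hI.prod hM) (by simp)).clm_comp
    contDiffOn_const).congr fun _ hz => famJetD_eq hI hM hf k hz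

theorem hasFDerivAt_famJet (hI : IsOpen I) (hM : IsOpen M)
    (hf : ContDiffOn ℝ ∞ (fun z : ℝ × E3 => f z.1 z.2) (I ×ˢ M)) (k : ℕ) {x : ℝ} {P : E3}
    (hx : x ∈ I) (hP : P ∈ M) :
    HasFDerivAt (famJet f k)
      ((ContinuousLinearMap.toSpanSingleton ℝ (famJet f (k + 1) (x, P))).coprod
        (famJetD f k (x, P))) (x, P) := by
  have h : HasFDerivAt (famJet f k) (fderiv ℝ (famJet f k) (x, P)) (x, P) :=
    (((contDiffOn_famJet hI hM hf k).contDiffAt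
      ((hI.prod hM).mem_nhds (mk_mem_prod hx hP))).differentiableAt (by simp)).hasFDerivAt
  refine h.congr_fderiv ?_
  have h4 := h.slice_left.unique (hasDerivAt_famJet hI hM hf k hx hP)
  refine ContinuousLinearMap.prod_ext ?_ ?_
  · ext
    simpa using h4
  · rw [← famJetD_eq hI hM hf k (mk_mem_prod hx hP)]
    ext
    simp

/-- Derivatives with respect to the variable and to the parameters commute. -/
theorem hasDerivAt_famJetD (hI : IsOpen I) (hM : IsOpen M)
    (hf : ContDiffOn ℝ ∞ (fun z : ℝ × E3 => f z.1 z.2) (I ×ˢ M)) (k : ℕ) {x : ℝ} {P : E3}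
    (hx : x ∈ I) (hP : P ∈ M) :
    HasDerivAt (fun t => famJetD f k (t, P)) (famJetD f (k + 1) (x, P)) x := by
  set g := famJet f k with hg
  have hgs : ContDiffOn ℝ ∞ g (I ×ˢ M) := contDiffOn_famJet hI hM hf k
  have hopen := hI.prod hM
  have hz : (x, P) ∈ I ×ˢ M := ⟨hx, hP⟩
  have hat : ContDiffAt ℝ ∞ g (x, P) := hgs.contDiffAt (hopen.mem_nhds hz)
  have hd2 : HasFDerivAt (fderiv ℝ g) (fderiv ℝ (fderiv ℝ g) (x, P)) (x, P) :=
    (((hgs.fderiv_of_isOpen (m := ∞) hopen (by simp)).contDiffAt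
      (hopen.mem_nhds hz)).differentiableAt (by simp)).hasFDerivAt
  have hsymm : IsSymmSndFDerivAt ℝ g (x, P) := hat.isSymmSndFDerivAt (by simpa using (mod_cast le_top : ((2 : ℕ∞) : WithTop ℕ∞) ≤ ∞))
  have h4 : HasDerivAt (fun t => fderiv ℝ g (t, P))
      (fderiv ℝ (fderiv ℝ g) (x, P) ((1 : ℝ), (0 : E3))) x := hd2.slice_left
  have h5 : HasDerivAt (fun t => (fderiv ℝ g (t, P)).comp (ContinuousLinearMap.inr ℝ ℝ E3))
      ((fderiv ℝ (fderiv ℝ g) (x, P) ((1 : ℝ), (0 : E3))).comp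
        (ContinuousLinearMap.inr ℝ ℝ E3)) x := by
    simpa using h4.clm_comp (hasDerivAt_const x (ContinuousLinearMap.inr ℝ ℝ E3))
  have h6 : famJetD f (k + 1) (x, P) = (fderiv ℝ (fderiv ℝ g) (x, P) ((1 : ℝ), (0 : E3))).comp
      (ContinuousLinearMap.inr ℝ ℝ E3) := by
    have h7 : HasFDerivAt (fun R : E3 => fderiv ℝ g (x, R) ((1 : ℝ), (0 : E3)))
        ((fderiv ℝ (fderiv ℝ g) (x, P) ((1 : ℝ), (0 : E3))).comp
          (ContinuousLinearMap.inr ℝ ℝ E3)) P := by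
      have h8 := hd2.slice_right.clm_apply
        (hasFDerivAt_const ((1 : ℝ), (0 : E3)) P)
      refine h8.congr_fderiv ?_
      ext v
      simpa using hsymm (0, v) (1, 0)
    refine (h7.congr_of_eventuallyEq ?_).fderiv
    filter_upwards [hM.mem_nhds hP] with R hR
    have h9 : HasFDerivAt g (fderiv ℝ g (x, R)) (x, R) :=
      ((hgs.contDiffAt (hopen.mem_nhds (mk_mem_prod hx hR))).differentiableAt
        (by simp)).hasFDerivAt
    exact (famJet_succ k x R).trans h9.slice_left.deriv
  rw [h6]
  refine h5.congr_of_eventuallyEq ?_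
  filter_upwards [hI.mem_nhds hx] with t ht
  exact famJetD_eq hI hM hf k ⟨ht, hP⟩

end FamJet

/-! ### Local solutions of third-order equations -/

section Equation

variable {D : Set (ℝ × ℝ × ℝ × ℝ)} {F : ℝ × ℝ × ℝ × ℝ → ℝ}

/-- The vector field on the 2-jet space whose integral curves are the 2-jets of solutions. -/
def jetField (F : ℝ × ℝ × ℝ × ℝ → ℝ) (z : ℝ × ℝ × ℝ × ℝ) : ℝ × ℝ × ℝ × ℝ :=
  (1, z.2.2.1, z.2.2.2, F z)

theorem IsSolutionOn.hasDerivAt_jetTwo {I : Set ℝ} {y : ℝ → ℝ} (hI : IsOpen I)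
    (hy : IsSolutionOn D F I y) {x : ℝ} (hx : x ∈ I) :
    HasDerivAt (jetTwo y) (jetField F (jetTwo y x)) x := by
  have h1 : ContDiffOn ℝ 2 (deriv y) I := hy.1.deriv_of_isOpen hI (by norm_num)
  have h2 : ContDiffOn ℝ 1 (deriv (deriv y)) I := h1.deriv_of_isOpen hI (by norm_num)
  have d0 : HasDerivAt y (deriv y x) x :=
    ((hy.1.contDiffAt (hI.mem_nhds hx)).differentiableAt (by simp)).hasDerivAt
  have d1 : HasDerivAt (deriv y) (iteratedDeriv 2 y x) x := by
    rw [iteratedDeriv_succ, iteratedDeriv_one]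
    exact ((h1.contDiffAt (hI.mem_nhds hx)).differentiableAt (by simp)).hasDerivAt
  have d2 : HasDerivAt (iteratedDeriv 2 y) (F (jetTwo y x)) x := by
    rw [← (hy.2 x hx).2, iteratedDeriv_succ (n := 2)]
    rw [show iteratedDeriv 2 y = deriv (deriv y) by rw [iteratedDeriv_succ, iteratedDeriv_one]]
    exact ((h2.contDiffAt (hI.mem_nhds hx)).differentiableAt (by simp)).hasDerivAt
  exact (hasDerivAt_id x).prodMk (d0.prodMk (d1.prodMk d2))

/-- The 2-jets are integral curves of a locally Lipschitz field, so the set where they agree locally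
is open; by continuity it is closed in the connected set `I`. -/
theorem IsSolutionOn.eqOn {I : Set ℝ} {y₁ y₂ : ℝ → ℝ} (hI : IsOpenInterval I) (hD : IsOpen D)
    (hF : ContDiffOn ℝ ∞ F D) (h₁ : IsSolutionOn D F I y₁) (h₂ : IsSolutionOn D F I y₂) {x₀ : ℝ}
    (hx₀ : x₀ ∈ I) (h : jetTwo y₁ x₀ = jetTwo y₂ x₀) : EqOn y₁ y₂ I := by
  have hloc : ∀ x ∈ I, jetTwo y₁ x = jetTwo y₂ x → jetTwo y₁ =ᶠ[𝓝 x] jetTwo y₂ := by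
    intro x hx hxe
    have hVc : ContDiffAt ℝ 1 (jetField F) (jetTwo y₁ x) := by
      have hFc : ContDiffAt ℝ 1 F (jetTwo y₁ x) :=
        (hF.contDiffAt (hD.mem_nhds (h₁.2 x hx).1)).of_le (by simp)
      exact contDiffAt_const.prodMk (contDiffAt_snd.snd.fst.prodMk
        (contDiffAt_snd.snd.snd.prodMk hFc))
    obtain ⟨K, s, hs, hK⟩ := hVc.exists_lipschitzOnWith
    have hev : ∀ {y : ℝ → ℝ}, IsSolutionOn D F I y → jetTwo y x = jetTwo y₁ x →
        ∀ᶠ t in 𝓝 x, HasDerivAt (jetTwo y) (jetField F (jetTwo y t)) t ∧ jetTwo y t ∈ s := by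
      intro y hy hyx
      refine Filter.Eventually.and ?_ ?_
      · filter_upwards [hI.1.mem_nhds hx] with t ht using hy.hasDerivAt_jetTwo hI.1 ht
      · exact (hy.hasDerivAt_jetTwo hI.1 hx).continuousAt.eventually (by rwa [hyx])
    exact ODE_solution_unique_of_eventually (v := fun _ => jetField F) (s := fun _ => s)
      (K := K) (Filter.Eventually.of_forall fun _ => hK) (hev h₁ rfl) (hev h₂ hxe.symm) hxe
  let U : Set ℝ := {x | jetTwo y₁ =ᶠ[𝓝 x] jetTwo y₂}
  have hU : IsOpen U := isOpen_setOfPred_eventually_nhds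
  have hIU : I ⊆ U := by
    refine hI.2.1.isPreconnected.subset_of_closure_inter_subset hU ⟨x₀, hx₀, hloc x₀ hx₀ h⟩ ?_
    rintro x ⟨hxU, hx⟩
    refine hloc x hx ?_
    have := mem_closure_iff_nhdsWithin_neBot.1 hxU
    refine tendsto_nhds_unique_of_eventuallyEq (l := 𝓝[U] x)
      ((h₁.hasDerivAt_jetTwo hI.1 hx).continuousAt.tendsto.mono_left nhdsWithin_le_nhds)
      ((h₂.hasDerivAt_jetTwo hI.1 hx).continuousAt.tendsto.mono_left nhdsWithin_le_nhds) ?_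
    filter_upwards [self_mem_nhdsWithin] with t (ht : jetTwo y₁ =ᶠ[𝓝 t] jetTwo y₂)
    exact ht.self_of_nhds
  intro x hx
  exact congrArg (fun z => z.2.1) (show jetTwo y₁ x = jetTwo y₂ x from (hIU hx).self_of_nhds)

/-- A smooth function on an open set agrees near any point of it with a smooth function on the
whole space. -/
theorem exists_contDiff_eqOn_ball {E : Type*} [NormedAddCommGroup E] [NormedSpace ℝ E]
    [FiniteDimensional ℝ E] {F : E → ℝ} {D : Set E} (hD : IsOpen D) (hF : ContDiffOn ℝ ∞ F D)
    {z : E} (hz : z ∈ D) :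
    ∃ (G : E → ℝ) (ρ : ℝ), 0 < ρ ∧ ContDiff ℝ ∞ G ∧ Metric.ball z ρ ⊆ D ∧
      EqOn G F (Metric.ball z ρ) := by
  obtain ⟨r, hr, hball⟩ := Metric.isOpen_iff.1 hD z hz
  let χ : ContDiffBump z := ⟨r / 4, r / 2, by linarith, by linarith⟩
  refine ⟨fun x => χ x * F x, r / 4, by linarith, ?_,
    (Metric.ball_subset_ball (by linarith)).trans hball, ?_⟩
  · refine contDiff_iff_contDiffAt.2 fun x => ?_
    by_cases hx : x ∈ D
    · exact χ.contDiffAt.mul (hF.contDiffAt (hD.mem_nhds hx))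
    · have hxs : x ∉ tsupport χ := by
        rw [χ.tsupport_eq]
        intro hx'
        refine hx (hball ?_)
        exact Metric.closedBall_subset_ball (show r / 2 < r by linarith) hx'
      refine (contDiffAt_const (c := (0 : ℝ))).congr_of_eventuallyEq ?_
      filter_upwards [notMem_tsupport_iff_eventuallyEq.1 hxs] with y hy
      simp [hy]
  · intro x hx
    have : χ x = 1 := χ.one_of_mem_closedBall (Metric.ball_subset_closedBall hx)
    simp [this]

/-- Initial data at `x₀` for a third-order equation. -/
def initialJet (x₀ : ℝ) (P : E3) : ℝ × ℝ × ℝ × ℝ := (x₀, P 0, P 1, P 2)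

theorem contDiff_initialJet (x₀ : ℝ) : ContDiff ℝ ∞ (initialJet x₀) := by
  unfold initialJet
  fun_prop

/-- The flow theorem needs a global field, so `F` is replaced by an extension `G` of its restriction
to a ball; the parameters are kept small enough for the jets to stay in that ball. -/
theorem exists_solution_family (hD : IsOpen D) (hF : ContDiffOn ℝ ∞ F D) {x₀ : ℝ} {P₀ : E3}
    (h₀ : initialJet x₀ P₀ ∈ D) :
    ∃ (δ : ℝ) (f : ℝ → E3 → ℝ), 0 < δ ∧
      ContDiffOn ℝ ∞ (fun z : ℝ × E3 => f z.1 z.2)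
        (Ioo (x₀ - δ) (x₀ + δ) ×ˢ Metric.ball P₀ δ) ∧
      ∀ P ∈ Metric.ball P₀ δ, IsSolutionOn D F (Ioo (x₀ - δ) (x₀ + δ)) (fun x => f x P) ∧
        jetTwo (fun x => f x P) x₀ = initialJet x₀ P := by
  obtain ⟨G, ρ, hρ, hG, hball, hGF⟩ := exists_contDiff_eqOn_ball hD hF h₀
  have hV : ContDiff ℝ ∞ (jetField G) :=
    contDiff_const.prodMk (contDiff_snd.snd.fst.prodMk (contDiff_snd.snd.snd.prodMk hG))
  obtain ⟨ε, φ, hε, hφ, hφ0, hφd⟩ := exists_contDiffOn_flow hV (initialJet x₀ P₀)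
  let ψ : ℝ × E3 → ℝ × ℝ × ℝ × ℝ := fun z => φ (z.1 - x₀, initialJet x₀ z.2)
  have hι : ContDiff ℝ ∞ fun z : ℝ × E3 => (z.1 - x₀, initialJet x₀ z.2) :=
    (contDiff_fst.sub contDiff_const).prodMk ((contDiff_initialJet x₀).comp contDiff_snd)
  have hb0 : ∀ᶠ z in 𝓝 (x₀, P₀), (z.1 - x₀, initialJet x₀ z.2) ∈
      Ioo (-ε) ε ×ˢ Metric.ball (initialJet x₀ P₀) ε := by
    refine hι.continuous.continuousAt.eventually ((isOpen_Ioo.prod Metric.isOpen_ball).mem_nhds ?_)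
    simp [hε]
  have hψ₀ : ψ (x₀, P₀) = initialJet x₀ P₀ := by
    simp [ψ, hφ0 _ (Metric.mem_ball_self hε)]
  have hψc : ContinuousAt ψ (x₀, P₀) :=
    ContinuousAt.comp (f := fun z : ℝ × E3 => (z.1 - x₀, initialJet x₀ z.2))
      (hφ.continuousOn.continuousAt
        ((isOpen_Ioo.prod Metric.isOpen_ball).mem_nhds hb0.self_of_nhds))
      hι.continuous.continuousAt
  have hb1 : ∀ᶠ z in 𝓝 (x₀, P₀), ψ z ∈ Metric.ball (initialJet x₀ P₀) ρ := by
    refine hψc.eventually ?_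
    rw [hψ₀]
    exact Metric.ball_mem_nhds _ hρ
  obtain ⟨δ, hδ, hδb⟩ := Metric.eventually_nhds_iff.1 (hb0.and hb1)
  have hmem : ∀ x ∈ Ioo (x₀ - δ) (x₀ + δ), ∀ P ∈ Metric.ball P₀ δ,
      (x - x₀, initialJet x₀ P) ∈ Ioo (-ε) ε ×ˢ Metric.ball (initialJet x₀ P₀) ε ∧
        ψ (x, P) ∈ Metric.ball (initialJet x₀ P₀) ρ := by
    intro x hx P hP
    refine hδb (y := (x, P)) ?_
    rw [Prod.dist_eq, Real.dist_eq]
    refine max_lt (abs_lt.2 ⟨?_, ?_⟩) hP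
    · linarith [hx.1]
    · linarith [hx.2]
  have hψs : ContDiffOn ℝ ∞ ψ (Ioo (x₀ - δ) (x₀ + δ) ×ˢ Metric.ball P₀ δ) :=
    hφ.comp hι.contDiffOn fun z hz => (hmem z.1 hz.1 z.2 hz.2).1
  have hψd : ∀ x ∈ Ioo (x₀ - δ) (x₀ + δ), ∀ P ∈ Metric.ball P₀ δ,
      HasDerivAt (fun t => ψ (t, P)) (jetField F (ψ (x, P))) x := by
    intro x hx P hP
    obtain ⟨h1, h2⟩ := hmem x hx P hP
    have h3 := (hφd _ h1.1 _ h1.2).scomp x ((hasDerivAt_id x).sub_const x₀)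
    rw [one_smul] at h3
    have h4 : jetField G (ψ (x, P)) = jetField F (ψ (x, P)) := by simp [jetField, hGF h2]
    rw [← h4]
    exact h3
  have hx₀ : x₀ ∈ Ioo (x₀ - δ) (x₀ + δ) := ⟨by linarith, by linarith⟩
  refine ⟨δ, fun x P => (ψ (x, P)).2.1, hδ, hψs.snd.fst, fun P hP => ?_⟩
  -- The first component of the autonomous field is `1`, so the first coordinate of the integral
  -- curve is the independent variable.
  have hfst : EqOn (fun t => (ψ (t, P)).1) id (Ioo (x₀ - δ) (x₀ + δ)) := by
    refine isOpen_Ioo.eqOn_of_deriv_eq isPreconnected_Ioo ?_ differentiableOn_id ?_ hx₀ ?_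
    · exact fun x hx => (hψd x hx P hP).prodFst.differentiableAt.differentiableWithinAt
    · intro x hx
      rw [(hψd x hx P hP).prodFst.deriv, deriv_id]
      rfl
    · simp [ψ, hφ0 _ (hmem x₀ hx₀ P hP).1.2]
      rfl
  have hd0 : ∀ x ∈ Ioo (x₀ - δ) (x₀ + δ), deriv (fun t => (ψ (t, P)).2.1) x = (ψ (x, P)).2.2.1 :=
    fun x hx => (hψd x hx P hP).prodSnd.prodFst.deriv
  have hd1 : ∀ x ∈ Ioo (x₀ - δ) (x₀ + δ),
      iteratedDeriv 2 (fun t => (ψ (t, P)).2.1) x = (ψ (x, P)).2.2.2 := by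
    intro x hx
    rw [iteratedDeriv_succ, iteratedDeriv_one]
    refine Filter.EventuallyEq.deriv_eq ?_ |>.trans (hψd x hx P hP).prodSnd.prodSnd.prodFst.deriv
    filter_upwards [isOpen_Ioo.mem_nhds hx] with t ht using hd0 t ht
  have hd2 : ∀ x ∈ Ioo (x₀ - δ) (x₀ + δ),
      iteratedDeriv 3 (fun t => (ψ (t, P)).2.1) x = F (ψ (x, P)) := by
    intro x hx
    rw [iteratedDeriv_succ]
    refine Filter.EventuallyEq.deriv_eq ?_ |>.trans (hψd x hx P hP).prodSnd.prodSnd.prodSnd.deriv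
    filter_upwards [isOpen_Ioo.mem_nhds hx] with t ht using hd1 t ht
  have hjet : ∀ x ∈ Ioo (x₀ - δ) (x₀ + δ), jetTwo (fun t => (ψ (t, P)).2.1) x = ψ (x, P) := by
    intro x hx
    rw [jetTwo, hd0 x hx, hd1 x hx]
    exact Prod.ext (hfst hx).symm rfl
  refine ⟨⟨?_, fun x hx => ?_⟩, ?_⟩
  · have h1 : ContDiffOn ℝ ∞ (fun x => ψ (x, P)) (Ioo (x₀ - δ) (x₀ + δ)) :=
      hψs.comp (contDiff_id.prodMk contDiff_const).contDiffOn fun x hx => ⟨hx, hP⟩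
    exact h1.snd.fst.of_le (mod_cast le_top : ((3 : ℕ∞) : WithTop ℕ∞) ≤ ∞)
  · rw [hjet x hx, hd2 x hx]
    exact ⟨hball (hmem x hx P hP).2, rfl⟩
  · rw [hjet x₀ hx₀]
    simp [ψ, hφ0 _ (hmem x₀ hx₀ P hP).1.2]

/-- Initial data are the coordinates, so the Wronskian matrix is the identity at `(x₀, P₀)`;
continuity keeps its determinant nonzero on a smaller product. -/
theorem exists_regularSolutionSpace (hD : IsOpen D) (hF : ContDiffOn ℝ ∞ F D) {x₀ : ℝ} {P₀ : E3}
    (h₀ : (x₀, P₀ 0, P₀ 1, P₀ 2) ∈ D) :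
    ∃ (I : Set ℝ) (M : Set E3) (f : ℝ → E3 → ℝ), x₀ ∈ I ∧ P₀ ∈ M ∧
      IsRegularSolutionSpace D F I M f ∧
      (∀ P ∈ M, jetTwo (fun x => f x P) x₀ = (x₀, P 0, P 1, P 2)) ∧
      (∀ P ∈ M, ∀ y : ℝ → ℝ, IsSolutionOn D F I y → jetTwo y x₀ = (x₀, P 0, P 1, P 2) →
        ∀ x ∈ I, y x = f x P) := by
  obtain ⟨δ, f, hδ, hf, hsol⟩ := exists_solution_family hD hF (x₀ := x₀) (P₀ := P₀) h₀
  have hx₀ : x₀ ∈ Ioo (x₀ - δ) (x₀ + δ) := ⟨by linarith, by linarith⟩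
  have hdet₀ : wronskianMatrix f x₀ P₀ = 1 := by
    ext k j
    have hk : famJet f k.1 ∘ Prod.mk x₀ =ᶠ[𝓝 P₀] fun R => R k := by
      filter_upwards [Metric.ball_mem_nhds P₀ hδ] with R hR
      have h := (hsol R hR).2
      simp only [jetTwo, initialJet, Prod.mk.injEq, true_and] at h
      fin_cases k
      · simpa [famJet] using h.1
      · simpa [famJet] using h.2.1
      · simpa [famJet] using h.2.2
    have hproj : HasFDerivAt (fun R : E3 => R k)
        (EuclideanSpace.proj k : E3 →L[ℝ] ℝ) P₀ := (EuclideanSpace.proj k : E3 →L[ℝ] ℝ).hasFDerivAt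
    have h := (hproj.congr_of_eventuallyEq hk).fderiv
    change fderiv ℝ (famJet f k.1 ∘ Prod.mk x₀) P₀ (EuclideanSpace.single j 1) = _
    rw [h]
    simp [Matrix.one_apply]
  have hdetc : ContinuousAt (fun z : ℝ × E3 => (wronskianMatrix f z.1 z.2).det) (x₀, P₀) := by
    have hd : Continuous (Matrix.det : Matrix (Fin 3) (Fin 3) ℝ → ℝ) :=
      Continuous.matrix_det continuous_id
    refine ContinuousAt.comp (g := Matrix.det) (f := fun z : ℝ × E3 =>
      wronskianMatrix f z.1 z.2) hd.continuousAt ?_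
    refine continuousAt_pi.2 fun k => continuousAt_pi.2 fun j => ?_
    have h1 : ContinuousAt (famJetD f k.1) (x₀, P₀) :=
      (contDiffOn_famJetD isOpen_Ioo Metric.isOpen_ball hf k.1).continuousOn.continuousAt
        ((isOpen_Ioo.prod Metric.isOpen_ball).mem_nhds ⟨hx₀, Metric.mem_ball_self hδ⟩)
    exact h1.clm_apply continuousAt_const
  have hne : ∀ᶠ z in 𝓝 (x₀, P₀), (wronskianMatrix f z.1 z.2).det ≠ 0 :=
    hdetc.eventually_ne (by simp [hdet₀])
  obtain ⟨η, hη, hηne⟩ := Metric.eventually_nhds_iff.1 hne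
  set r := min δ η with hr
  have hr0 : 0 < r := lt_min hδ hη
  have hIsub : Ioo (x₀ - r) (x₀ + r) ⊆ Ioo (x₀ - δ) (x₀ + δ) :=
    Ioo_subset_Ioo (by linarith [min_le_left δ η]) (by linarith [min_le_left δ η])
  have hMsub : Metric.ball P₀ r ⊆ Metric.ball P₀ δ := Metric.ball_subset_ball (min_le_left _ _)
  have hI : IsOpenInterval (Ioo (x₀ - r) (x₀ + r)) := .ioo (by linarith)
  have hx₀r : x₀ ∈ Ioo (x₀ - r) (x₀ + r) := ⟨by linarith, by linarith⟩
  have hsol' : ∀ P ∈ Metric.ball P₀ r,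
      IsSolutionOn D F (Ioo (x₀ - r) (x₀ + r)) (fun x => f x P) := fun P hP =>
    ⟨(hsol P (hMsub hP)).1.1.mono hIsub, fun x hx => (hsol P (hMsub hP)).1.2 x (hIsub hx)⟩
  refine ⟨Ioo (x₀ - r) (x₀ + r), Metric.ball P₀ r, f, hx₀r, Metric.mem_ball_self hr0,
    ⟨hI, Metric.isOpen_ball, hf.mono (prod_mono hIsub hMsub), hsol', ?_⟩,
    fun P hP => (hsol P (hMsub hP)).2, ?_⟩
  · intro x hx P hP
    refine hηne (y := (x, P)) ?_
    rw [Prod.dist_eq, Real.dist_eq]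
    refine max_lt (abs_lt.2 ⟨?_, ?_⟩) (lt_of_lt_of_le hP (min_le_right _ _))
    · linarith [hx.1, min_le_right δ η]
    · linarith [hx.2, min_le_right δ η]
  · intro P hP y hy hyx
    exact hy.eqOn hI hD hF (hsol' P hP) hx₀r (hyx.trans (hsol P (hMsub hP)).2.symm)

end Equation

/-! ### Auxiliary facts -/

theorem exists_continuousLinearEquiv_of_injective {X Y : Type*} [NormedAddCommGroup X]
    [NormedSpace ℝ X] [FiniteDimensional ℝ X] [NormedAddCommGroup Y] [NormedSpace ℝ Y]
    [FiniteDimensional ℝ Y] (L : X →L[ℝ] Y) (hL : ∀ v, L v = 0 → v = 0)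
    (hdim : Module.finrank ℝ X = Module.finrank ℝ Y) :
    ∃ e : X ≃L[ℝ] Y, (e : X →L[ℝ] Y) = L := by
  have hinj : Function.Injective (L : X →ₗ[ℝ] Y) :=
    (injective_iff_map_eq_zero (L : X →ₗ[ℝ] Y)).2 hL
  refine ⟨((L : X →ₗ[ℝ] Y).linearEquivOfInjective hinj hdim).toContinuousLinearEquiv, ?_⟩
  ext v
  rfl

/-- The mean value theorem on an interval, without an order on the end points. -/
theorem Set.OrdConnected.exists_sub_eq_mul {J : Set ℝ} (hJ : J.OrdConnected) {u u' : ℝ → ℝ}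
    (hu : ∀ t ∈ J, HasDerivAt u (u' t) t) {a b : ℝ} (ha : a ∈ J) (hb : b ∈ J) (hab : a ≠ b) :
    ∃ ξ ∈ J, 0 < (ξ - a) * (b - a) ∧ u b - u a = u' ξ * (b - a) := by
  rcases lt_or_gt_of_ne hab with h | h
  · have hsub := hJ.out ha hb
    obtain ⟨c, hc, hce⟩ := exists_hasDerivAt_eq_slope u u' h
      (fun t ht => (hu t (hsub ht)).continuousAt.continuousWithinAt)
      (fun t ht => hu t (hsub (Ioo_subset_Icc_self ht)))
    refine ⟨c, hsub (Ioo_subset_Icc_self hc), mul_pos (sub_pos.2 hc.1) (sub_pos.2 h), ?_⟩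
    rw [hce, div_mul_cancel₀ _ (sub_pos.2 h).ne']
  · have hsub := hJ.out hb ha
    obtain ⟨c, hc, hce⟩ := exists_hasDerivAt_eq_slope u u' h
      (fun t ht => (hu t (hsub ht)).continuousAt.continuousWithinAt)
      (fun t ht => hu t (hsub (Ioo_subset_Icc_self ht)))
    refine ⟨c, hsub (Ioo_subset_Icc_self hc),
      mul_pos_of_neg_of_neg (sub_neg.2 hc.2) (sub_neg.2 h), ?_⟩
    rw [hce, ← neg_sub a b, mul_neg, div_mul_cancel₀ _ (sub_pos.2 h).ne']
    ring

theorem Set.OrdConnected.mul_pos_of_ne_zero {J : Set ℝ} (hJ : J.OrdConnected) {g : ℝ → ℝ}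
    (hg : ContinuousOn g J) (hne : ∀ t ∈ J, g t ≠ 0) {a b : ℝ} (ha : a ∈ J) (hb : b ∈ J) :
    0 < g a * g b := by
  by_contra hcon
  have hoc : (g '' J).OrdConnected := (hJ.isPreconnected.image g hg).ordConnected
  have h0 : (0 : ℝ) ∈ uIcc (g a) (g b) := by
    rw [mem_uIcc]
    rcases mul_nonpos_iff.1 (not_lt.1 hcon) with h | h
    · exact Or.inr ⟨h.2, h.1⟩
    · exact Or.inl h
  obtain ⟨t, ht, ht0⟩ := hoc.uIcc_subset (mem_image_of_mem g ha) (mem_image_of_mem g hb) h0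
  exact hne t ht ht0

/-- A curve of lines is embedded in the projective plane if for every parameter `α` the sign of a
quadratic form that is a product of two linear forms tells the parameters before `α` from those
after it. -/
theorem isEmbedding_projectivization_mk {J : Set ℝ} (hJ : IsOpen J) {γ : ℝ → E3}
    (hγ : ∀ t ∈ J, γ t ≠ 0) (hc : ContinuousOn γ J)
    (hsep : ∀ α ∈ J, ∃ A B : E3 →L[ℝ] ℝ, ∀ t ∈ J,
      (0 < A (γ t) * B (γ t) ↔ t < α) ∧ (A (γ t) * B (γ t) < 0 ↔ α < t)) :
    IsEmbedding (fun t : J => Projectivization.mk ℝ (γ t) (hγ t t.2)) := by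
  set φ : J → ℙ ℝ E3 := fun t => Projectivization.mk ℝ (γ t) (hγ t t.2) with hφ
  have hφc : Continuous φ := by
    have h1 : Continuous (Projectivization.mk' ℝ : {v : E3 // v ≠ 0} → ℙ ℝ E3) :=
      continuous_coinduced_rng
    have h2 : Continuous fun t : J => (⟨γ t, hγ t t.2⟩ : {v : E3 // v ≠ 0}) :=
      (continuousOn_iff_continuous_domRestrict.1 hc).subtype_mk _
    exact h1.comp h2
  have hopen : ∀ A B : E3 →L[ℝ] ℝ, ∃ O : Set (ℙ ℝ E3), IsOpen O ∧
      ∀ (v : E3) (hv : v ≠ 0), Projectivization.mk ℝ v hv ∈ O ↔ 0 < A v * B v := by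
    intro A B
    -- The form is homogeneous of degree two, so its sign depends only on the line.
    let O : ℙ ℝ E3 → Prop := Projectivization.lift (fun v => 0 < A v * B v) (by
      rintro ⟨a, ha⟩ ⟨b, hb⟩ t rfl
      have ht : t ≠ 0 := fun h => ha (by simp [h])
      have : A (t • b) * B (t • b) = t ^ 2 * (A b * B b) := by
        simp only [map_smul, smul_eq_mul]
        ring
      simp only [this, eq_iff_iff]
      exact mul_pos_iff_of_pos_left (by positivity))
    refine ⟨{ℓ | O ℓ}, ?_, fun v hv => Iff.rfl⟩
    refine isOpen_coinduced.2 ?_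
    exact isOpen_lt continuous_const
      ((A.continuous.comp continuous_subtype_val).mul (B.continuous.comp continuous_subtype_val))
  have hlt : ∀ α ∈ J, ∃ O : Set (ℙ ℝ E3), IsOpen O ∧ ∀ t : J, φ t ∈ O ↔ (t : ℝ) < α := by
    intro α hα
    obtain ⟨A, B, hAB⟩ := hsep α hα
    obtain ⟨O, hO, hOm⟩ := hopen A B
    exact ⟨O, hO, fun t => (hOm _ _).trans (hAB t t.2).1⟩
  have hgt : ∀ α ∈ J, ∃ O : Set (ℙ ℝ E3), IsOpen O ∧ ∀ t : J, φ t ∈ O ↔ α < (t : ℝ) := by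
    intro α hα
    obtain ⟨A, B, hAB⟩ := hsep α hα
    obtain ⟨O, hO, hOm⟩ := hopen (-A) B
    refine ⟨O, hO, fun t => (hOm _ _).trans (Iff.trans ?_ (hAB t t.2).2)⟩
    simp
  refine ⟨isInducing_iff_nhds.2 fun x =>
    le_antisymm (hφc.tendsto x).le_comap fun s hs => ?_, ?_⟩
  · obtain ⟨u, hu, hus⟩ := (mem_nhds_induced Subtype.val x s).1 hs
    obtain ⟨δ, hδ, hball⟩ :=
      Metric.mem_nhds_iff.1 (Filter.inter_mem hu (hJ.mem_nhds x.2))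
    have hmem : ∀ t : ℝ, (x : ℝ) - δ / 2 ≤ t → t ≤ x + δ / 2 → t ∈ u ∩ J := by
      intro t h1 h2
      refine hball ?_
      rw [Metric.mem_ball, Real.dist_eq, abs_lt]
      constructor <;> linarith
    obtain ⟨O₁, hO₁, hm₁⟩ := hgt ((x : ℝ) - δ / 2) (hmem _ le_rfl (by linarith)).2
    obtain ⟨O₂, hO₂, hm₂⟩ := hlt ((x : ℝ) + δ / 2) (hmem _ (by linarith) le_rfl).2
    refine ⟨O₁ ∩ O₂, (hO₁.inter hO₂).mem_nhds
      ⟨(hm₁ x).2 (by linarith), (hm₂ x).2 (by linarith)⟩, fun t ht => hus ?_⟩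
    exact (hmem t ((hm₁ t).1 ht.1).le ((hm₂ t).1 ht.2).le).1
  · intro s t hst
    rcases lt_trichotomy (s : ℝ) t with h | h | h
    · obtain ⟨O, -, hO⟩ := hlt t t.2
      exact absurd ((hO t).1 (hst ▸ (hO s).2 h)) (lt_irrefl _)
    · exact Subtype.ext h
    · obtain ⟨O, -, hO⟩ := hlt s s.2
      exact absurd ((hO s).1 (hst ▸ (hO t).2 h)) (lt_irrefl _)

theorem incidentAt_iff_famJet {f : ℝ → E3 → ℝ} {x : ℝ} {P Q : E3} :
    IncidentAt f x P Q ↔ famJet f 0 (x, P) = famJet f 0 (x, Q) ∧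
      famJet f 1 (x, P) = famJet f 1 (x, Q) := by
  simp [IncidentAt, famJet]

theorem IncidentAt.symm {f : ℝ → E3 → ℝ} {x : ℝ} {P Q : E3} (h : IncidentAt f x P Q) :
    IncidentAt f x Q P := ⟨h.1.symm, h.2.symm⟩

theorem IncidentAt.trans {f : ℝ → E3 → ℝ} {x : ℝ} {P Q R : E3} (h : IncidentAt f x P Q)
    (h' : IncidentAt f x Q R) : IncidentAt f x P R := ⟨h.1.trans h'.1, h.2.trans h'.2⟩

/-! ### Neighbourhoods on which incidence is a causal geometry -/

/-- Conditions on `J` and `W` under which incidence in the family `f` is a causal geometry. -/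
structure IsIncidenceNbhd (f : ℝ → E3 → ℝ) (J : Set ℝ) (W : Set E3) : Prop where
  isOpenInterval : IsOpenInterval J
  isOpen : IsOpen W
  convex : Convex ℝ W
  smooth : ContDiffOn ℝ ∞ (fun z : ℝ × E3 => f z.1 z.2) (J ×ˢ W)
  -- The three base points are independent because separate applications of the mean value theorem
  -- produce them.
  eq_zero : ∀ z₀ ∈ J ×ˢ W, ∀ z₁ ∈ J ×ˢ W, ∀ z₂ ∈ J ×ˢ W, ∀ v,
    famJetD f 0 z₀ v = 0 → famJetD f 1 z₁ v = 0 → famJetD f 2 z₂ v = 0 → v = 0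
  -- That `T` is an interval encodes connectedness within `W`; the parameter is the second
  -- derivative at `x`.
  exists_curve : ∀ x ∈ J, ∀ P ∈ W, ∃ (T : Set ℝ) (c : ℝ → E3), IsOpenInterval T ∧
    ContDiffOn ℝ ∞ c T ∧ c '' T = {R ∈ W | IncidentAt f x P R} ∧
    ∀ t ∈ T, famJet f 2 (x, c t) = t
  exists_direction : ∀ P ∈ W, ∃ w : ℝ → E3, ContDiffOn ℝ ∞ w J ∧ ∀ x ∈ J,
    famJetD f 0 (x, P) (w x) = 0 ∧ famJetD f 1 (x, P) (w x) = 0 ∧ famJetD f 2 (x, P) (w x) = 1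

namespace IsIncidenceNbhd

variable {f : ℝ → E3 → ℝ} {J : Set ℝ} {W : Set E3}

theorem hasFDerivAt_famJet_right (h : IsIncidenceNbhd f J W) (k : ℕ) {x : ℝ} (hx : x ∈ J)
    {P : E3} (hP : P ∈ W) :
    HasFDerivAt (fun R => famJet f k (x, R)) (famJetD f k (x, P)) P := by
  have h1 := (hasFDerivAt_famJet h.isOpenInterval.1 h.isOpen h.smooth k hx hP).slice_right
  exact h1.congr_fderiv (by ext; simp)

/-! ### Uniqueness and signs from the mean value theorem -/

/-- Each equality puts `Q - P` in the kernel of a parameter differential at some point of the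
segment, which lies in the convex set `W`. -/
theorem eq_of_famJet_eq (h : IsIncidenceNbhd f J W) {P Q : E3} (hP : P ∈ W) (hQ : Q ∈ W)
    {x₀ x₁ x₂ : ℝ} (h₀ : x₀ ∈ J) (h₁ : x₁ ∈ J) (h₂ : x₂ ∈ J)
    (e₀ : famJet f 0 (x₀, P) = famJet f 0 (x₀, Q)) (e₁ : famJet f 1 (x₁, P) = famJet f 1 (x₁, Q))
    (e₂ : famJet f 2 (x₂, P) = famJet f 2 (x₂, Q)) : P = Q := by
  have key : ∀ (k : ℕ) (x : ℝ), x ∈ J → famJet f k (x, P) = famJet f k (x, Q) →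
      ∃ z ∈ J ×ˢ W, famJetD f k z (Q - P) = 0 := by
    intro k x hx hk
    obtain ⟨R, hR, hRe⟩ := domain_mvt (f := fun R => famJet f k (x, R))
      (f' := fun R => famJetD f k (x, R)) (s := W)
      (fun R hR => (h.hasFDerivAt_famJet_right k hx hR).hasFDerivWithinAt) h.convex hP hQ
    refine ⟨(x, R), ⟨hx, h.convex.segment_subset hP hQ hR⟩, ?_⟩
    rw [← hRe, hk, sub_self]
  obtain ⟨z₀, hz₀, hv₀⟩ := key 0 x₀ h₀ e₀
  obtain ⟨z₁, hz₁, hv₁⟩ := key 1 x₁ h₁ e₁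
  obtain ⟨z₂, hz₂, hv₂⟩ := key 2 x₂ h₂ e₂
  exact (sub_eq_zero.1 (h.eq_zero z₀ hz₀ z₁ hz₁ z₂ hz₂ _ hv₀ hv₁ hv₂)).symm

theorem hasDerivAt_famJet_sub (h : IsIncidenceNbhd f J W) (k : ℕ) {P Q : E3} (hP : P ∈ W)
    (hQ : Q ∈ W) {x : ℝ} (hx : x ∈ J) :
    HasDerivAt (fun t => famJet f k (t, P) - famJet f k (t, Q))
      (famJet f (k + 1) (x, P) - famJet f (k + 1) (x, Q)) x :=
  (hasDerivAt_famJet h.isOpenInterval.1 h.isOpen h.smooth k hx hP).sub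
    (hasDerivAt_famJet h.isOpenInterval.1 h.isOpen h.smooth k hx hQ)

/-- By Rolle, a second agreement of first derivatives forces an agreement of second derivatives.
Values at `x'` play no role, which is what the local equation of the cone requires. -/
theorem eq_of_incidentAt (h : IsIncidenceNbhd f J W) {P Q : E3} (hP : P ∈ W) (hQ : Q ∈ W)
    {x x' : ℝ} (hx : x ∈ J) (hx' : x' ∈ J) (hPQ : P ≠ Q) (hi : IncidentAt f x P Q)
    (hi' : famJet f 1 (x', P) = famJet f 1 (x', Q)) : x = x' := by
  by_contra hne
  obtain ⟨e₀, e₁⟩ := incidentAt_iff_famJet.1 hi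
  obtain ⟨ξ, hξ, -, he⟩ := h.isOpenInterval.2.1.exists_sub_eq_mul
    (fun t ht => h.hasDerivAt_famJet_sub 1 hP hQ ht) hx hx' hne
  have h2 : famJet f 2 (ξ, P) - famJet f 2 (ξ, Q) = 0 := by
    have : (famJet f 2 (ξ, P) - famJet f 2 (ξ, Q)) * (x' - x) = 0 := by
      rw [← he, hi', e₁]
      ring
    exact (mul_eq_zero.1 this).resolve_right (sub_ne_zero.2 (Ne.symm hne))
  exact hPQ (h.eq_of_famJet_eq hP hQ hx hx hξ e₀ e₁ (sub_eq_zero.1 h2))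

theorem incidentAt_unique (h : IsIncidenceNbhd f J W) {P Q : E3} (hP : P ∈ W) (hQ : Q ∈ W)
    {x x' : ℝ} (hx : x ∈ J) (hx' : x' ∈ J) (hPQ : P ≠ Q) (hi : IncidentAt f x P Q)
    (hi' : IncidentAt f x' P Q) : x = x' :=
  h.eq_of_incidentAt hP hQ hx hx' hPQ hi (incidentAt_iff_famJet.1 hi').2

/-- The difference of two incident solutions has a strict sign away from the point of incidence. -/
theorem mul_sub_pos (h : IsIncidenceNbhd f J W) {P Q : E3} (hP : P ∈ W) (hQ : Q ∈ W) {a : ℝ}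
    (ha : a ∈ J) (hPQ : P ≠ Q) (hi : IncidentAt f a P Q) {x x' : ℝ} (hx : x ∈ J) (hx' : x' ∈ J)
    (hxa : a ≠ x) (hxa' : a ≠ x') :
    0 < (famJet f 0 (x, P) - famJet f 0 (x, Q)) * (famJet f 0 (x', P) - famJet f 0 (x', Q)) := by
  obtain ⟨e₀, e₁⟩ := incidentAt_iff_famJet.1 hi
  -- Two mean value steps starting from `a`; the factor is `m = (ξ - a)(y - a)`, positive because
  -- `ξ` and `y` lie on the same side of `a`.
  have key : ∀ y ∈ J, a ≠ y → ∃ η ∈ J, ∃ m > 0, famJet f 0 (y, P) - famJet f 0 (y, Q) =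
      (famJet f 2 (η, P) - famJet f 2 (η, Q)) * m := by
    intro y hy hay
    obtain ⟨ξ, hξ, hpos, he⟩ := h.isOpenInterval.2.1.exists_sub_eq_mul
      (fun t ht => h.hasDerivAt_famJet_sub 0 hP hQ ht) ha hy hay
    have hξa : a ≠ ξ := by
      rintro rfl
      simp at hpos
    obtain ⟨η, hη, -, he'⟩ := h.isOpenInterval.2.1.exists_sub_eq_mul
      (fun t ht => h.hasDerivAt_famJet_sub 1 hP hQ ht) ha hξ hξa
    refine ⟨η, hη, _, hpos, ?_⟩
    simp only [e₀, e₁, sub_self, sub_zero, zero_add, one_add_one_eq_two] at he he'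
    rw [he, he', mul_assoc]
  obtain ⟨η, hη, m, hm, he⟩ := key x hx hxa
  obtain ⟨η', hη', m', hm', he'⟩ := key x' hx' hxa'
  -- The second derivatives differ everywhere on `J`, since values and first derivatives already
  -- agree at `a`.
  have hs := h.isOpenInterval.2.1.mul_pos_of_ne_zero
    (g := fun t => famJet f 2 (t, P) - famJet f 2 (t, Q))
    (fun t ht => (h.hasDerivAt_famJet_sub 2 hP hQ ht).continuousAt.continuousWithinAt)
    (fun t ht hz => hPQ (h.eq_of_famJet_eq hP hQ ha ha ht e₀ e₁ (sub_eq_zero.1 hz))) hη hη'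
  rw [he, he', mul_mul_mul_comm]
  exact mul_pos hs (mul_pos hm hm')

/-- Three pairwise incident solutions are incident at a common point. -/
theorem eq_of_pairwise_incidentAt (h : IsIncidenceNbhd f J W) {P Q R : E3} (hP : P ∈ W)
    (hQ : Q ∈ W) (hR : R ∈ W) (hPQ : P ≠ Q) (hQR : Q ≠ R) (hPR : P ≠ R) {a b c : ℝ} (ha : a ∈ J)
    (hb : b ∈ J) (hc : c ∈ J) (hia : IncidentAt f a P Q) (hib : IncidentAt f b Q R)
    (hic : IncidentAt f c P R) : b = c := by
  by_contra hbc
  have hab : a ≠ b := by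
    rintro rfl
    exact hbc (h.incidentAt_unique hP hR hb hc hPR (hia.trans hib) hic)
  have hac : a ≠ c := by
    rintro rfl
    exact hbc (h.incidentAt_unique hQ hR hb hc hQR hib (hia.symm.trans hic))
  have h1 := h.mul_sub_pos hP hQ ha hPQ hia hb hc hab hac
  have h2 := h.mul_sub_pos hQ hR hb hQR hib ha hc hab.symm hbc
  have h3 := h.mul_sub_pos hP hR hc hPR hic ha hb hac.symm (Ne.symm hbc)
  have ea := (incidentAt_iff_famJet.1 hia).1
  have eb := (incidentAt_iff_famJet.1 hib).1
  have ec := (incidentAt_iff_famJet.1 hic).1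
  rw [← ea, ← ec] at h2
  rw [← eb] at h3
  -- The three sign conditions read `XZ > 0`, `-YZ > 0`, `XY > 0`; their product is `-(XYZ)² > 0`,
  -- which is absurd.
  set X := famJet f 0 (b, P) - famJet f 0 (b, Q)
  set Y := famJet f 0 (a, P) - famJet f 0 (a, R)
  set Z := famJet f 0 (c, P) - famJet f 0 (c, Q)
  have h2' : 0 < Y * (-Z) := by
    have : -Z = famJet f 0 (c, Q) - famJet f 0 (c, P) := by ring
    rwa [this]
  nlinarith [mul_pos (mul_pos h1 h2') h3, sq_nonneg (X * Y * Z)]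

/-! ### The cone as a hypersurface and its tangent planes -/

/-- Two linear forms on `ℝ³` have a common nonzero zero, so the third cannot vanish identically. -/
theorem famJetD_zero_ne_zero (h : IsIncidenceNbhd f J W) {z : ℝ × E3} (hz : z ∈ J ×ˢ W) :
    famJetD f 0 z ≠ 0 := by
  intro h0
  let L : E3 →ₗ[ℝ] ℝ × ℝ := ((famJetD f 1 z).prod (famJetD f 2 z) : E3 →L[ℝ] ℝ × ℝ)
  have hker : LinearMap.ker L ≠ ⊥ := LinearMap.ker_ne_bot_of_finrank_lt (by simp)
  obtain ⟨v, hv, hv0⟩ := Submodule.exists_mem_ne_zero_of_ne_bot hker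
  have hv' : (famJetD f 1 z v, famJetD f 2 z v) = (0, 0) := hv
  exact hv0 (h.eq_zero z hz z hz z hz v (by simp [h0]) (congrArg Prod.fst hv')
    (congrArg Prod.snd hv'))

/-- Away from its vertex, the incidence cone is locally the zero set of a submersion whose
differential is that of the value of solutions at the point of incidence. -/
theorem exists_defining_function (h : IsIncidenceNbhd f J W) {P Q : E3} (hP : P ∈ W) (hQ : Q ∈ W)
    (hPQ : P ≠ Q) {a : ℝ} (ha : a ∈ J) (hi : IncidentAt f a P Q) :
    ∃ V : Set E3, IsOpen V ∧ Q ∈ V ∧ P ∉ V ∧ ∃ g : E3 → ℝ, ContDiffOn ℝ ∞ g V ∧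
      (∀ R ∈ V, fderiv ℝ g R ≠ 0) ∧ incidenceCone J W f P ∩ V = {R ∈ V | g R = 0} ∧
      fderiv ℝ g Q = famJetD f 0 (a, Q) := by
  have hJo := h.isOpenInterval.1
  obtain ⟨e₀, e₁⟩ := incidentAt_iff_famJet.1 hi
  let Ω : Set (ℝ × E3) := J ×ˢ (W ∩ {P}ᶜ)
  have hΩ : IsOpen Ω := hJo.prod (h.isOpen.inter isOpen_compl_singleton)
  have hΩsub : Ω ⊆ J ×ˢ W := prod_mono_right inter_subset_left
  -- Inverting `H` solves `f_x(x; R) = f_x(x; P)` for `x = X R`. This is possible near `(a, Q)`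
  -- because the second derivatives of `P` and `Q` differ at `a`.
  let H : ℝ × E3 → ℝ × E3 := fun z => (famJet f 1 z - famJet f 1 (z.1, P), z.2)
  have hjet : ∀ k, ContDiffOn ℝ ∞ (famJet f k) (J ×ˢ W) :=
    contDiffOn_famJet hJo h.isOpen h.smooth
  have hjetP : ∀ k, ContDiffOn ℝ ∞ (fun z : ℝ × E3 => famJet f k (z.1, P)) Ω := fun k =>
    (hjet k).comp (contDiff_fst.prodMk contDiff_const).contDiffOn fun z hz => ⟨hz.1, hP⟩
  have hH : ContDiffOn ℝ ∞ H Ω :=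
    (((hjet 1).mono hΩsub).sub (hjetP 1)).prodMk contDiff_snd.contDiffOn
  have haΩ : (a, Q) ∈ Ω := ⟨ha, hQ, hPQ.symm⟩
  have hHd : HasFDerivAt H (fderiv ℝ H (a, Q)) (a, Q) :=
    ((hH.contDiffAt (hΩ.mem_nhds haΩ)).differentiableAt (by simp)).hasFDerivAt
  have hHd' : HasFDerivAt H
      ((((ContinuousLinearMap.toSpanSingleton ℝ (famJet f 2 (a, Q))).coprod (famJetD f 1 (a, Q)) -
        (ContinuousLinearMap.toSpanSingleton ℝ (famJet f 2 (a, P))).comp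
          (ContinuousLinearMap.fst ℝ ℝ E3)).prod (ContinuousLinearMap.snd ℝ ℝ E3))) (a, Q) := by
    refine HasFDerivAt.prodMk ?_ hasFDerivAt_snd
    refine (hasFDerivAt_famJet hJo h.isOpen h.smooth 1 ha hQ).sub ?_
    have h1 := (hasDerivAt_famJet hJo h.isOpen h.smooth 1 ha hP).hasFDerivAt
    exact HasFDerivAt.comp (g := fun t => famJet f 1 (t, P)) (f := Prod.fst) (a, Q) h1
      hasFDerivAt_fst
  obtain ⟨e, he⟩ := exists_continuousLinearEquiv_of_injective (fderiv ℝ H (a, Q)) (by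
    rintro ⟨t, v⟩ htv
    rw [hHd'.fderiv] at htv
    simp only [ContinuousLinearMap.prod_apply, Prod.mk_eq_zero] at htv
    obtain ⟨h1, h2⟩ := htv
    have hv : v = 0 := by simpa using h2
    subst hv
    have h3 : t * (famJet f 2 (a, Q) - famJet f 2 (a, P)) = 0 := by
      rw [← h1]
      simp
      ring
    have h4 : famJet f 2 (a, Q) - famJet f 2 (a, P) ≠ 0 := fun h0 =>
      hPQ (h.eq_of_famJet_eq hP hQ ha ha ha e₀ e₁ (sub_eq_zero.1 h0).symm)
    rw [(mul_eq_zero.1 h3).resolve_right h4]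
    rfl) rfl
  obtain ⟨Φ, hΦ, haΦ, hΦΩ, hsymm⟩ :=
    exists_openPartialHomeomorph_of_contDiffOn hΩ hH haΩ e (by rwa [he])
  let V : Set E3 := {R | ((0 : ℝ), R) ∈ Φ.target}
  have hV : IsOpen V := Φ.open_target.preimage (by fun_prop)
  have hHa : H (a, Q) = (0, Q) := by simp [H, e₁]
  have hQt : ((0 : ℝ), Q) ∈ Φ.target := by
    rw [← hHa, ← hΦ]
    exact Φ.map_source haΦ
  let X : E3 → ℝ := fun R => (Φ.symm (0, R)).1
  have hX : ∀ R ∈ V, Φ.symm (0, R) = (X R, R) ∧ (X R, R) ∈ Ω ∧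
      famJet f 1 (X R, R) = famJet f 1 (X R, P) := by
    intro R hR
    have h1 : H (Φ.symm (0, R)) = (0, R) := by rw [← hΦ, Φ.right_inv hR]
    have h2 : Φ.symm (0, R) = (X R, R) :=
      Prod.ext rfl (show (Φ.symm (0, R)).2 = R from congrArg Prod.snd h1)
    refine ⟨h2, h2 ▸ hΦΩ (Φ.map_target hR), ?_⟩
    rw [h2] at h1
    exact sub_eq_zero.1 (congrArg Prod.fst h1)
  have hXQ : X Q = a := by
    have : Φ.symm (0, Q) = (a, Q) := by rw [← hHa, ← hΦ, Φ.left_inv haΦ]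
    exact congrArg Prod.fst this
  have hXs : ContDiffOn ℝ ∞ X V :=
    (hsymm.comp (contDiff_const.prodMk contDiff_id).contDiffOn fun R hR => hR).fst
  have hXR : ContDiffOn ℝ ∞ (fun R => (X R, R)) V := hXs.prodMk contDiffOn_id
  let g : E3 → ℝ := fun R => famJet f 0 (X R, R) - famJet f 0 (X R, P)
  have hg : ContDiffOn ℝ ∞ g V :=
    ((hjet 0).comp hXR fun R hR => hΩsub (hX R hR).2.1).sub
      ((hjet 0).comp (hXs.prodMk contDiffOn_const) fun R hR => ⟨(hX R hR).2.1.1, hP⟩)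
  -- Envelope computation: the differential of `X` is multiplied by the difference of first
  -- derivatives at `X R`, which is zero.
  have hgd : ∀ R ∈ V, fderiv ℝ g R = famJetD f 0 (X R, R) := by
    intro R hR
    obtain ⟨-, ⟨hXJ, hRW, -⟩, he1⟩ := hX R hR
    have hXd : HasFDerivAt X (fderiv ℝ X R) R :=
      ((hXs.contDiffAt (hV.mem_nhds hR)).differentiableAt (by simp)).hasFDerivAt
    have h1 := HasFDerivAt.comp (f := fun R => (X R, R)) R
      (hasFDerivAt_famJet hJo h.isOpen h.smooth 0 hXJ hRW) (hXd.prodMk (hasFDerivAt_id R))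
    have h2 := HasFDerivAt.comp (f := X) R
      (hasDerivAt_famJet hJo h.isOpen h.smooth 0 hXJ hP).hasFDerivAt hXd
    have h3 : HasFDerivAt g _ R := h1.sub h2
    rw [h3.fderiv]
    ext v
    simp [he1]
  refine ⟨V, hV, hQt, fun hPV => (hX P hPV).2.1.2.2 rfl, g, hg, fun R hR => ?_, ?_, ?_⟩
  · rw [hgd R hR]
    exact h.famJetD_zero_ne_zero (hΩsub (hX R hR).2.1)
  · ext R
    constructor
    · rintro ⟨⟨hRW, x, hx, hxi⟩, hRV⟩
      refine ⟨hRV, ?_⟩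
      obtain ⟨-, ⟨hXJ, -, hRP⟩, he1⟩ := hX R hRV
      -- An incidence anywhere in `J`, not only near `a`, must occur at `X R`.
      have hxX : x = X R := h.eq_of_incidentAt hP hRW hx hXJ (Ne.symm hRP) hxi he1.symm
      have := (incidentAt_iff_famJet.1 hxi).1
      simp only [g, ← hxX, this, sub_self]
    · rintro ⟨hRV, hgR⟩
      obtain ⟨-, ⟨hXJ, hRW, -⟩, he1⟩ := hX R hRV
      exact ⟨⟨hRW, X R, hXJ, incidentAt_iff_famJet.2 ⟨(sub_eq_zero.1 hgR).symm, he1.symm⟩⟩, hRV⟩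
  · rw [hgd Q hQt, hXQ]

/-- The plane depends on `P` only through the incidence point `a`; this is the source of the
envelope condition. -/
theorem tangentVectors_incidenceCone (h : IsIncidenceNbhd f J W) {P Q : E3} (hP : P ∈ W)
    (hQ : Q ∈ W) (hPQ : P ≠ Q) {a : ℝ} (ha : a ∈ J) (hi : IncidentAt f a P Q) :
    tangentVectors (incidenceCone J W f P) Q = {v | famJetD f 0 (a, Q) v = 0} := by
  obtain ⟨V, hV, hQV, -, g, hg, hd, hS, hgQ⟩ := h.exists_defining_function hP hQ hPQ ha hi
  rw [tangentVectors_eq_ker hV hQV hg (hd Q hQV) hS ⟨hQ, a, ha, hi⟩, hgQ]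

/-! ### The curves of the pencil and their tangent lines -/

theorem incidenceCurve_eq (h : IsIncidenceNbhd f J W) {P Q : E3} (hP : P ∈ W)
    (hQ : Q ∈ W) (hPQ : P ≠ Q) {a : ℝ} (ha : a ∈ J) (hi : IncidentAt f a P Q) :
    incidenceCurve J W f P Q = {R ∈ W | IncidentAt f a P R} := by
  ext R
  constructor
  · rintro ⟨hR, x, hx, hxQ, hxR⟩
    rw [h.incidentAt_unique hP hQ hx ha hPQ hxQ hi] at hxR
    exact ⟨hR, hxR⟩
  · rintro ⟨hR, hRi⟩
    exact ⟨hR, a, ha, hi, hRi⟩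

/-- The second derivative at `x` is a differentiable left inverse of the parametrization, which is
therefore an immersion and an embedding. -/
theorem isEmbeddedCurve (h : IsIncidenceNbhd f J W) {x : ℝ} (hx : x ∈ J) {P : E3} (hP : P ∈ W) :
    IsEmbeddedCurve {R ∈ W | IncidentAt f x P R} := by
  obtain ⟨T, c, hT, hc, himg, hct⟩ := h.exists_curve x hx P hP
  have hcW : ∀ t ∈ T, c t ∈ W := fun t ht => by
    have hct : c t ∈ {R ∈ W | IncidentAt f x P R} := himg ▸ mem_image_of_mem c ht
    exact hct.1
  refine ⟨T, c, hT, hc, fun t ht h0 => ?_, ?_, himg⟩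
  · have hcd : HasDerivAt c (deriv c t) t :=
      ((hc.contDiffAt (hT.1.mem_nhds ht)).differentiableAt (by simp)).hasDerivAt
    have h1 := (h.hasFDerivAt_famJet_right 2 hx (hcW t ht)).comp_hasDerivAt t hcd
    rw [h0, map_zero] at h1
    have h2 : (fun R => famJet f 2 (x, R)) ∘ c =ᶠ[𝓝 t] id := by
      filter_upwards [hT.1.mem_nhds ht] with s hs using hct s hs
    exact zero_ne_one (h1.unique ((hasDerivAt_id t).congr_of_eventuallyEq h2))
  · let F : T → W := fun t => ⟨c t, hcW t t.2⟩
    have hF : Continuous F :=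
      (continuousOn_iff_continuous_domRestrict.1 hc.continuousOn).subtype_mk _
    let G : W → ℝ := fun R => famJet f 2 (x, R)
    have hG : Continuous G := continuousOn_iff_continuous_domRestrict.1
      (fun R hR => (h.hasFDerivAt_famJet_right 2 hx hR).continuousAt.continuousWithinAt)
    have hGF : G ∘ F = Subtype.val := funext fun t => hct t t.2
    have hFe : IsEmbedding F := .of_comp hF hG (hGF ▸ IsEmbedding.subtypeVal)
    exact IsEmbedding.subtypeVal.comp hFe

/-- It ensures that every `x ∈ J` contributes a curve to the pencil and a direction to the
indicatrix. An open parameter set containing the parameter of `P` has other points. -/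
theorem exists_incidentAt_ne (h : IsIncidenceNbhd f J W) {x : ℝ} (hx : x ∈ J) {P : E3}
    (hP : P ∈ W) : ∃ Q ∈ W, P ≠ Q ∧ IncidentAt f x P Q := by
  obtain ⟨T, c, hT, hc, himg, hct⟩ := h.exists_curve x hx P hP
  have hPc : P ∈ c '' T := by
    rw [himg]
    exact ⟨hP, rfl, rfl⟩
  obtain ⟨t, ht, rfl⟩ := hPc
  obtain ⟨s, hs, hst⟩ : ∃ s ∈ T, s ≠ t := by
    obtain ⟨ε, hε, hball⟩ := Metric.isOpen_iff.1 hT.1 t ht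
    refine ⟨t + ε / 2, hball ?_, by linarith⟩
    rw [Metric.mem_ball, Real.dist_eq, abs_lt]
    constructor <;> linarith
  have hsc : c s ∈ {R ∈ W | IncidentAt f x (c t) R} := himg ▸ mem_image_of_mem c hs
  refine ⟨c s, hsc.1, fun hcs => hst ?_, hsc.2⟩
  rw [← hct s hs, ← hct t ht, hcs]

/-- Along the curve `f` and `f_x` at `x` are constant, so `eq_zero` leaves one direction; its
normalization by `f_xx` is the velocity of the given parametrization. -/
theorem tangentVectors_eq_line (h : IsIncidenceNbhd f J W) {x : ℝ} (hx : x ∈ J) {P : E3}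
    (hP : P ∈ W) {w : E3} (h₀ : famJetD f 0 (x, P) w = 0) (h₁ : famJetD f 1 (x, P) w = 0)
    (h₂ : famJetD f 2 (x, P) w = 1) :
    w ∈ tangentVectors {R ∈ W | IncidentAt f x P R} P ∧
      ∀ v ∈ tangentVectors {R ∈ W | IncidentAt f x P R} P, v = famJetD f 2 (x, P) v • w := by
  have hmem : (x, P) ∈ J ×ˢ W := ⟨hx, hP⟩
  have hzero : ∀ (k : ℕ) (γ : ℝ → E3) (ε : ℝ), 0 < ε → ContDiffOn ℝ ∞ γ (Ioo (-ε) ε) → γ 0 = P →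
      (∀ t ∈ Ioo (-ε) ε, famJet f k (x, γ t) = famJet f k (x, P)) →
      famJetD f k (x, P) (deriv γ 0) = 0 := by
    intro k γ ε hε hγ h0 hk
    have hIoo : Ioo (-ε) ε ∈ 𝓝 (0 : ℝ) := Ioo_mem_nhds (by linarith) hε
    have hγd : HasDerivAt γ (deriv γ 0) 0 :=
      ((hγ.contDiffAt hIoo).differentiableAt (by simp)).hasDerivAt
    have h1 : HasDerivAt ((fun R => famJet f k (x, R)) ∘ γ) (famJetD f k (x, P) (deriv γ 0)) 0 := by
      refine HasFDerivAt.comp_hasDerivAt (0 : ℝ) ?_ hγd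
      rw [h0]
      exact h.hasFDerivAt_famJet_right k hx hP
    have h2 : (fun R => famJet f k (x, R)) ∘ γ =ᶠ[𝓝 0] fun _ => famJet f k (x, P) := by
      filter_upwards [hIoo] with t ht using hk t ht
    exact h1.unique ((hasDerivAt_const (0 : ℝ) _).congr_of_eventuallyEq h2)
  constructor
  · obtain ⟨T, c, hT, hc, himg, hct⟩ := h.exists_curve x hx P hP
    have hPc : P ∈ c '' T := by
      rw [himg]
      exact ⟨hP, rfl, rfl⟩
    obtain ⟨t₀, ht₀, htP⟩ := hPc
    obtain ⟨ε, hε, hball⟩ := Metric.isOpen_iff.1 hT.1 t₀ ht₀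
    have hmaps : MapsTo (fun t => t₀ + t) (Ioo (-ε) ε) T := by
      intro t ht
      refine hball ?_
      rw [Metric.mem_ball, Real.dist_eq, add_sub_cancel_left]
      exact abs_lt.2 ht
    have hγ : ContDiffOn ℝ ∞ (fun t => c (t₀ + t)) (Ioo (-ε) ε) :=
      hc.comp (contDiff_const.add contDiff_id).contDiffOn hmaps
    have hγS : ∀ t ∈ Ioo (-ε) ε, c (t₀ + t) ∈ {R ∈ W | IncidentAt f x P R} := fun t ht =>
      himg ▸ mem_image_of_mem c (hmaps ht)
    have hγ0 : c (t₀ + 0) = P := by rw [add_zero, htP]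
    refine ⟨ε, fun t => c (t₀ + t), hε, hγ, hγS, hγ0, ?_⟩
    have hd₀ := hzero 0 _ ε hε hγ hγ0
      fun t ht => (incidentAt_iff_famJet.1 (hγS t ht).2).1.symm
    have hd₁ := hzero 1 _ ε hε hγ hγ0
      fun t ht => (incidentAt_iff_famJet.1 (hγS t ht).2).2.symm
    have hd₂ : famJetD f 2 (x, P) (deriv (fun t => c (t₀ + t)) 0) = 1 := by
      have hIoo : Ioo (-ε) ε ∈ 𝓝 (0 : ℝ) := Ioo_mem_nhds (by linarith) hε
      have hγd : HasDerivAt (fun t => c (t₀ + t)) (deriv (fun t => c (t₀ + t)) 0) 0 :=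
        ((hγ.contDiffAt hIoo).differentiableAt (by simp)).hasDerivAt
      have h1 : HasDerivAt ((fun R => famJet f 2 (x, R)) ∘ fun t => c (t₀ + t))
          (famJetD f 2 (x, P) (deriv (fun t => c (t₀ + t)) 0)) 0 := by
        refine HasFDerivAt.comp_hasDerivAt (0 : ℝ) ?_ hγd
        rw [hγ0]
        exact h.hasFDerivAt_famJet_right 2 hx hP
      have h2 : ((fun R => famJet f 2 (x, R)) ∘ fun t => c (t₀ + t)) =ᶠ[𝓝 0] fun t => t₀ + t := by
        filter_upwards [hIoo] with t ht using hct _ (hmaps ht)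
      exact h1.unique (((hasDerivAt_id (0 : ℝ)).const_add t₀).congr_of_eventuallyEq h2)
    refine sub_eq_zero.1 (h.eq_zero _ hmem _ hmem _ hmem _ ?_ ?_ ?_) <;> rw [map_sub]
    · rw [hd₀, h₀, sub_self]
    · rw [hd₁, h₁, sub_self]
    · rw [hd₂, h₂, sub_self]
  · rintro v ⟨ε, γ, hε, hγ, hγS, h0, rfl⟩
    have hd₀ := hzero 0 γ ε hε hγ h0 fun t ht => (incidentAt_iff_famJet.1 (hγS t ht).2).1.symm
    have hd₁ := hzero 1 γ ε hε hγ h0 fun t ht => (incidentAt_iff_famJet.1 (hγS t ht).2).2.symm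
    refine sub_eq_zero.1 (h.eq_zero _ hmem _ hmem _ hmem _ ?_ ?_ ?_) <;>
      simp [h₀, h₁, h₂, hd₀, hd₁]

/-! ### Nondegeneracy of the indicatrix -/

/-- Write `Aₖ` for the parameter differential of the `k`-th derivative, so `Aₖ' = Aₖ₊₁`.
Differentiating `A₀w = 0`, `A₁w = 0` gives `A₀w' = 0`, `A₁w' = -1`, and then `A₀w'' = 1`. -/
theorem isRegularCurve_indicatrix (h : IsIncidenceNbhd f J W) {P : E3} (hP : P ∈ W) :
    IsRegularCurveWithoutSecondOrderContact
      (indicatrix (incidenceCone J W f) (incidenceCurve J W f) P) := by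
  obtain ⟨w, hw, hwx⟩ := h.exists_direction P hP
  have hJo := h.isOpenInterval.1
  have hAd : ∀ (k : ℕ), ∀ x ∈ J,
      HasDerivAt (fun t => famJetD f k (t, P)) (famJetD f (k + 1) (x, P)) x := fun k x hx =>
    hasDerivAt_famJetD hJo h.isOpen h.smooth k hx hP
  have hw0 : ∀ t ∈ J, w t ≠ 0 := by
    intro t ht h0
    have := (hwx t ht).2.2
    rw [h0, map_zero] at this
    exact zero_ne_one this
  have hw1 : ContDiffOn ℝ ∞ (deriv w) J := hw.deriv_of_isOpen hJo (by simp)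
  have hwd : ∀ t ∈ J, HasDerivAt w (deriv w t) t := fun t ht =>
    ((hw.contDiffAt (hJo.mem_nhds ht)).differentiableAt (by simp)).hasDerivAt
  have hwd' : ∀ t ∈ J, HasDerivAt (deriv w) (iteratedDeriv 2 w t) t := by
    intro t ht
    rw [iteratedDeriv_succ, iteratedDeriv_one]
    exact ((hw1.contDiffAt (hJo.mem_nhds ht)).differentiableAt (by simp)).hasDerivAt
  have hpair : ∀ (k : ℕ) (v v' : ℝ → E3), (∀ t ∈ J, HasDerivAt v (v' t) t) →
      (∀ t ∈ J, famJetD f k (t, P) (v t) = 0) → ∀ t ∈ J,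
      famJetD f (k + 1) (t, P) (v t) + famJetD f k (t, P) (v' t) = 0 := by
    intro k v v' hv hz t ht
    have h1 := (hAd k t ht).clm_apply (hv t ht)
    refine h1.unique ((hasDerivAt_const t (0 : ℝ)).congr_of_eventuallyEq ?_)
    filter_upwards [hJo.mem_nhds ht] with s hs using hz s hs
  have h0' : ∀ t ∈ J, famJetD f 0 (t, P) (deriv w t) = 0 := by
    intro t ht
    have := hpair 0 w _ hwd (fun s hs => (hwx s hs).1) t ht
    rwa [(hwx t ht).2.1, zero_add] at this
  have h1' : ∀ t ∈ J, famJetD f 1 (t, P) (deriv w t) = -1 := by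
    intro t ht
    have := hpair 1 w _ hwd (fun s hs => (hwx s hs).2.1) t ht
    rw [(hwx t ht).2.2] at this
    linarith
  have h0'' : ∀ t ∈ J, famJetD f 0 (t, P) (iteratedDeriv 2 w t) = 1 := by
    intro t ht
    have := hpair 0 _ _ hwd' h0' t ht
    rw [h1' t ht] at this
    linarith
  refine ⟨J, w, hw0, h.isOpenInterval, hw, ?_, ?_, fun t ht => ?_, fun t ht hmem => ?_⟩
  · refine isEmbedding_projectivization_mk hJo hw0 hw.continuousOn fun α hα =>
      ⟨famJetD f 1 (α, P), famJetD f 2 (α, P), fun t ht => ?_⟩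
    have hne : ∀ ξ ∈ J, famJetD f 2 (ξ, P) (w t) ≠ 0 := fun ξ hξ h2 => hw0 t ht
      (h.eq_zero (t, P) ⟨ht, hP⟩ (t, P) ⟨ht, hP⟩ (ξ, P) ⟨hξ, hP⟩ _ (hwx t ht).1 (hwx t ht).2.1 h2)
    have hd : ∀ (k : ℕ), ∀ s ∈ J, HasDerivAt (fun s => famJetD f k (s, P) (w t))
        (famJetD f (k + 1) (s, P) (w t)) s := fun k s hs => by
      simpa using (hAd k s hs).clm_apply (hasDerivAt_const s (w t))
    -- For fixed `t`, the function `s ↦ A₁(s)(w t)` vanishes at `t` and its derivative `A₂(s)(w t)`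
    -- has constant sign; so `A₁A₂` at `α` has the sign of `α - t`.
    have hkey : ∃ m > 0, famJetD f 1 (α, P) (w t) * famJetD f 2 (α, P) (w t) = m * (α - t) := by
      rcases eq_or_ne t α with rfl | hta
      · exact ⟨1, one_pos, by rw [(hwx t ht).2.1]; ring⟩
      · obtain ⟨ξ, hξ, -, he⟩ := h.isOpenInterval.2.1.exists_sub_eq_mul (hd 1) ht hα hta
        rw [(hwx t ht).2.1, sub_zero] at he
        refine ⟨_, h.isOpenInterval.2.1.mul_pos_of_ne_zero
          (fun s hs => (hd 2 s hs).continuousAt.continuousWithinAt) hne hξ hα, ?_⟩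
        rw [he]
        ring
    obtain ⟨m, hm, he⟩ := hkey
    rw [he]
    constructor
    · rw [mul_pos_iff_of_pos_left hm, sub_pos]
    · rw [← neg_pos, ← mul_neg, mul_pos_iff_of_pos_left hm, neg_sub, sub_pos]
  · ext ℓ
    constructor
    · rintro ⟨⟨t, ht⟩, rfl⟩
      obtain ⟨Q, hQ, hPQ, hi⟩ := h.exists_incidentAt_ne ht hP
      refine ⟨Q, ⟨⟨hQ, t, ht, hi⟩, hPQ.symm⟩, w t, hw0 t ht, ?_, rfl⟩
      rw [h.incidenceCurve_eq hP hQ hPQ ht hi]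
      exact (h.tangentVectors_eq_line ht hP (hwx t ht).1 (hwx t ht).2.1 (hwx t ht).2.2).1
    · rintro ⟨Q, ⟨⟨hQ, t, ht, hi⟩, hPQ⟩, v, hv, hvt, rfl⟩
      rw [h.incidenceCurve_eq hP hQ (Ne.symm hPQ) ht hi] at hvt
      have hvw := (h.tangentVectors_eq_line ht hP (hwx t ht).1 (hwx t ht).2.1
        (hwx t ht).2.2).2 v hvt
      refine ⟨⟨t, ht⟩, ?_⟩
      have hne : famJetD f 2 (t, P) v ≠ 0 := by
        intro h0
        rw [h0, zero_smul] at hvw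
        exact hv hvw
      refine (Projectivization.mk_eq_mk_iff' ℝ _ _ _ _).2 ⟨(famJetD f 2 (t, P) v)⁻¹, ?_⟩
      nth_rewrite 2 [hvw]
      rw [smul_smul, inv_mul_cancel₀ hne, one_smul]
  · refine LinearIndependent.pair_iff.2 fun a b hab => ?_
    have h1 := congrArg (famJetD f 1 (t, P)) hab
    rw [map_add, map_smul, map_smul, (hwx t ht).2.1, h1' t ht, map_zero] at h1
    have hb : b = 0 := by simpa using h1
    rw [hb, zero_smul, add_zero] at hab
    exact ⟨(smul_eq_zero.1 hab).resolve_right (hw0 t ht), hb⟩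
  -- The plane of the tangent line lies in the kernel of `A₀`, where `w''` is not.
  · have hle : Submodule.span ℝ {w t, deriv w t} ≤
        LinearMap.ker (famJetD f 0 (t, P) : E3 →ₗ[ℝ] ℝ) := by
      rw [Submodule.span_le]
      rintro v (rfl | rfl)
      · exact (hwx t ht).1
      · exact h0' t ht
    have h1 : famJetD f 0 (t, P) (iteratedDeriv 2 w t) = 0 := hle hmem
    rw [h0'' t ht] at h1
    exact one_ne_zero h1

theorem isCausalGeometry (h : IsIncidenceNbhd f J W) :
    IsCausalGeometry W (incidenceCone J W f) (incidenceCurve J W f) where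
  isOpen := h.isOpen
  cone_subset := fun P _ Q hQ => hQ.1
  vertex_mem := fun P hP => by
    obtain ⟨x, hx⟩ := h.isOpenInterval.2.2
    exact ⟨hP, x, hx, rfl, rfl⟩
  axiom_one := by
    rintro P hP Q ⟨⟨hQ, x, hx, hi⟩, hPQ⟩
    obtain ⟨V, hV, hQV, hPV, g, hg, hd, hS, -⟩ :=
      h.exists_defining_function hP hQ (Ne.symm hPQ) hx hi
    refine ⟨V, hV, hQV, g, hg, hd, ?_⟩
    rw [← hS]
    ext R
    constructor
    · rintro ⟨⟨h1, -⟩, h2⟩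
      exact ⟨h1, h2⟩
    · rintro ⟨h1, h2⟩
      exact ⟨⟨h1, fun hRP => hPV (hRP ▸ h2)⟩, h2⟩
  axiom_two := by
    intro P hP
    refine ⟨?_, ?_, ?_⟩
    · rintro Q ⟨⟨hQ, x, hx, hi⟩, hPQ⟩
      rw [h.incidenceCurve_eq hP hQ (Ne.symm hPQ) hx hi]
      exact ⟨h.isEmbeddedCurve hx hP, ⟨hP, rfl, rfl⟩, ⟨hQ, hi⟩⟩
    · ext R
      simp only [mem_iUnion]
      constructor
      · rintro ⟨hR, x, hx, hi⟩
        obtain ⟨Q, hQ, hPQ, hQi⟩ := h.exists_incidentAt_ne hx hP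
        exact ⟨Q, ⟨⟨hQ, x, hx, hQi⟩, hPQ.symm⟩, hR, x, hx, hQi, hi⟩
      · rintro ⟨Q, -, hR, x, hx, -, hi⟩
        exact ⟨hR, x, hx, hi⟩
    · rintro Q ⟨⟨hQ, x, hx, hi⟩, hPQ⟩ Q' ⟨⟨hQ', x', hx', hi'⟩, hPQ'⟩
      rw [h.incidenceCurve_eq hP hQ (Ne.symm hPQ) hx hi,
        h.incidenceCurve_eq hP hQ' (Ne.symm hPQ') hx' hi']
      rcases eq_or_ne x x' with rfl | hne
      · exact Or.inl rfl
      · refine Or.inr (Subset.antisymm ?_ ?_)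
        · rintro R ⟨⟨hR, h1⟩, -, h2⟩
          by_contra hRP
          exact hne (h.incidentAt_unique hP hR hx hx' (Ne.symm hRP) h1 h2)
        · rintro R rfl
          exact ⟨⟨hP, rfl, rfl⟩, hP, rfl, rfl⟩
  axiom_three := by
    intro P _ Q _
    ext R
    constructor
    · rintro ⟨hR, x, hx, h1, h2⟩
      exact ⟨hR, x, hx, h1.symm, h1.symm.trans h2⟩
    · rintro ⟨hR, x, hx, h1, h2⟩
      exact ⟨hR, x, hx, h1.symm, h1.symm.trans h2⟩
  axiom_four := fun P hP => h.isRegularCurve_indicatrix hP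
  axiom_five := by
    rintro P hP Q ⟨⟨hQ, a, ha, hia⟩, hPQ⟩ R ⟨⟨hR, c, hc, hic⟩, hPR⟩ hQR ⟨-, b, hb, hib⟩ -
    -- Both tangent planes are kernels of the differential of `f` at incidence points with `R`, and
    -- these points coincide.
    rw [h.tangentVectors_incidenceCone hP hR (Ne.symm hPR) hc hic,
      h.tangentVectors_incidenceCone hQ hR hQR hb hib,
      h.eq_of_pairwise_incidentAt hP hQ hR (Ne.symm hPQ) hQR (Ne.symm hPR) ha hb hc hia hib hic]

end IsIncidenceNbhd

/-! ### Construction of the neighbourhoods from the Wronskian condition -/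

section Existence

variable {f : ℝ → E3 → ℝ} {I : Set ℝ} {M : Set E3}

theorem eq_zero_of_wronskianMatrix_det_ne_zero {x : ℝ} {P : E3}
    (hdet : (wronskianMatrix f x P).det ≠ 0) {v : E3} (h₀ : famJetD f 0 (x, P) v = 0)
    (h₁ : famJetD f 1 (x, P) v = 0) (h₂ : famJetD f 2 (x, P) v = 0) : v = 0 := by
  have hv : v = ∑ j, v j • EuclideanSpace.single j (1 : ℝ) := by
    simpa using ((EuclideanSpace.basisFun (Fin 3) ℝ).sum_repr v).symm
  have hk : ∀ k : Fin 3, ((wronskianMatrix f x P).mulVec v.ofLp) k = famJetD f k (x, P) v := by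
    intro k
    have h1 : famJetD f k (x, P) v =
        ∑ j, v j * famJetD f k (x, P) (EuclideanSpace.single j (1 : ℝ)) := by
      conv_lhs => rw [hv, map_sum]
      simp only [map_smul, smul_eq_mul]
    rw [h1, Matrix.mulVec, dotProduct]
    exact Finset.sum_congr rfl fun j _ =>
      mul_comm (famJetD f k (x, P) (EuclideanSpace.single j (1 : ℝ))) (v j)
  have h0 : v.ofLp = 0 := by
    refine Matrix.eq_zero_of_mulVec_eq_zero hdet (funext fun k => ?_)
    rw [hk]
    fin_cases k
    · exact h₀
    · exact h₁
    · exact h₂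
  ext j
  exact congrFun h0 j

/-- The 2-jets of a family of functions, together with the point at which they are taken. -/
noncomputable def famJetMap (f : ℝ → E3 → ℝ) (z : ℝ × E3) : ℝ × ℝ × ℝ × ℝ :=
  (z.1, famJet f 0 z, famJet f 1 z, famJet f 2 z)

/-- The differential is block triangular, with the Wronskian matrix as the block in the parameters.
-/
theorem exists_famJetMap_inverse (hI : IsOpen I) (hM : IsOpen M)
    (hf : ContDiffOn ℝ ∞ (fun z : ℝ × E3 => f z.1 z.2) (I ×ˢ M)) {x₀ : ℝ} {P₀ : E3}
    (hx₀ : x₀ ∈ I) (hP₀ : P₀ ∈ M) (hdet : (wronskianMatrix f x₀ P₀).det ≠ 0) :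
    ∃ Φ : OpenPartialHomeomorph (ℝ × E3) (ℝ × ℝ × ℝ × ℝ), (∀ z, Φ z = famJetMap f z) ∧
      (x₀, P₀) ∈ Φ.source ∧ Φ.source ⊆ I ×ˢ M ∧ ContDiffOn ℝ ∞ Φ.symm Φ.target := by
  have hj := contDiffOn_famJet hI hM hf
  have hs : ContDiffOn ℝ ∞ (famJetMap f) (I ×ˢ M) :=
    contDiff_fst.contDiffOn.prodMk ((hj 0).prodMk ((hj 1).prodMk (hj 2)))
  have hd := fun k => hasFDerivAt_famJet hI hM hf k hx₀ hP₀
  have hd' : HasFDerivAt (famJetMap f) _ (x₀, P₀) :=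
    hasFDerivAt_fst.prodMk ((hd 0).prodMk ((hd 1).prodMk (hd 2)))
  obtain ⟨e, he⟩ := exists_continuousLinearEquiv_of_injective
    (fderiv ℝ (famJetMap f) (x₀, P₀)) (by
      rintro ⟨t, v⟩ htv
      rw [hd'.fderiv] at htv
      simp only [ContinuousLinearMap.prod_apply, Prod.mk_eq_zero] at htv
      obtain ⟨h1, h2, h3, h4⟩ := htv
      have ht : t = 0 := h1
      subst ht
      simp only [ContinuousLinearMap.coprod_apply, map_zero, zero_add] at h2 h3 h4
      rw [eq_zero_of_wronskianMatrix_det_ne_zero hdet h2 h3 h4]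
      rfl) (by simp)
  exact exists_openPartialHomeomorph_of_contDiffOn (hI.prod hM) hs ⟨hx₀, hP₀⟩ e
    (by rw [he]; exact hd'.differentiableAt.hasFDerivAt)

/-- Invertibility is an open condition on the triple of differentials, viewed as a function of three
independent base points. -/
theorem exists_ball_eq_zero_of_famJetD (hI : IsOpen I) (hM : IsOpen M)
    (hf : ContDiffOn ℝ ∞ (fun z : ℝ × E3 => f z.1 z.2) (I ×ˢ M)) {x₀ : ℝ} {P₀ : E3}
    (hx₀ : x₀ ∈ I) (hP₀ : P₀ ∈ M) (hdet : (wronskianMatrix f x₀ P₀).det ≠ 0) :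
    ∃ δ > 0, ∀ z₀ ∈ Metric.ball (x₀, P₀) δ, ∀ z₁ ∈ Metric.ball (x₀, P₀) δ,
      ∀ z₂ ∈ Metric.ball (x₀, P₀) δ, ∀ v,
      famJetD f 0 z₀ v = 0 → famJetD f 1 z₁ v = 0 → famJetD f 2 z₂ v = 0 → v = 0 := by
  let L : (ℝ × E3) × (ℝ × E3) × (ℝ × E3) → E3 →L[ℝ] ℝ × ℝ × ℝ := fun z =>
    (famJetD f 0 z.1).prod ((famJetD f 1 z.2.1).prod (famJetD f 2 z.2.2))
  set a : ℝ × E3 := (x₀, P₀) with ha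
  obtain ⟨e, he⟩ := exists_continuousLinearEquiv_of_injective (L (a, a, a)) (by
    intro v hv
    simp only [L, ContinuousLinearMap.prod_apply, Prod.mk_eq_zero] at hv
    exact eq_zero_of_wronskianMatrix_det_ne_zero hdet hv.1 hv.2.1 hv.2.2) (by simp)
  have hc : ∀ k, ContinuousAt (famJetD f k) a := fun k =>
    (contDiffOn_famJetD hI hM hf k).continuousOn.continuousAt
      ((hI.prod hM).mem_nhds ⟨hx₀, hP₀⟩)
  have hL : ContinuousAt L (a, a, a) := by
    have h0 : ContinuousAt (fun z : (ℝ × E3) × (ℝ × E3) × (ℝ × E3) => famJetD f 0 z.1) (a, a, a) :=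
      ContinuousAt.comp (g := famJetD f 0) (hc 0) (by fun_prop)
    have h1 : ContinuousAt (fun z : (ℝ × E3) × (ℝ × E3) × (ℝ × E3) => famJetD f 1 z.2.1)
        (a, a, a) := ContinuousAt.comp (g := famJetD f 1) (hc 1) (by fun_prop)
    have h2 : ContinuousAt (fun z : (ℝ × E3) × (ℝ × E3) × (ℝ × E3) => famJetD f 2 z.2.2)
        (a, a, a) := ContinuousAt.comp (g := famJetD f 2) (hc 2) (by fun_prop)
    have hp := (ContinuousLinearMap.prodₗᵢ (𝕜 := ℝ) (E := E3) (F := ℝ) (G := ℝ × ℝ) ℝ).continuous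
    have hp' := (ContinuousLinearMap.prodₗᵢ (𝕜 := ℝ) (E := E3) (F := ℝ) (G := ℝ) ℝ).continuous
    exact hp.continuousAt.comp (h0.prodMk (hp'.continuousAt.comp (h1.prodMk h2)))
  have hev : ∀ᶠ z in 𝓝 (a, a, a), L z ∈ range ((↑) : (E3 ≃L[ℝ] ℝ × ℝ × ℝ) → E3 →L[ℝ] ℝ × ℝ × ℝ) :=
    hL.eventually (he ▸ ContinuousLinearEquiv.nhds e)
  obtain ⟨δ, hδ, hball⟩ := Metric.eventually_nhds_iff.1 hev
  refine ⟨δ, hδ, fun z₀ h₀ z₁ h₁ z₂ h₂ v e₀ e₁ e₂ => ?_⟩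
  obtain ⟨e', he'⟩ := hball (y := (z₀, z₁, z₂)) (by
    rw [Prod.dist_eq, Prod.dist_eq]
    exact max_lt h₀ (max_lt h₁ h₂))
  have : e' v = 0 := by
    change (e' : E3 →L[ℝ] ℝ × ℝ × ℝ) v = 0
    rw [he']
    simp [L, e₀, e₁, e₂]
  exact (map_eq_zero_iff e' e'.injective).1 this

theorem exists_isIncidenceNbhd (hI : IsOpen I) (hM : IsOpen M)
    (hf : ContDiffOn ℝ ∞ (fun z : ℝ × E3 => f z.1 z.2) (I ×ˢ M)) {x₀ : ℝ} {P₀ : E3}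
    (hx₀ : x₀ ∈ I) (hP₀ : P₀ ∈ M) (hdet : (wronskianMatrix f x₀ P₀).det ≠ 0) {U : Set ℝ}
    (hU : U ∈ 𝓝 x₀) {V : Set E3} (hV : V ∈ 𝓝 P₀) :
    ∃ (J : Set ℝ) (W : Set E3), x₀ ∈ J ∧ J ⊆ I ∩ U ∧ P₀ ∈ W ∧ W ⊆ M ∩ V ∧
      IsIncidenceNbhd f J W := by
  obtain ⟨Φ, hΦ, h0Φ, hΦsub, hsymm⟩ := exists_famJetMap_inverse hI hM hf hx₀ hP₀ hdet
  obtain ⟨δ₁, hδ₁, hnd⟩ := exists_ball_eq_zero_of_famJetD hI hM hf hx₀ hP₀ hdet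
  let e₄ : ℝ × ℝ × ℝ × ℝ := (0, 0, 0, 1)
  let ψ : ℝ × ℝ × ℝ × ℝ → E3 := fun z => (Φ.symm z).2
  have hψ : ContDiffOn ℝ ∞ ψ Φ.target := hsymm.snd
  let ψ₁ : ℝ × ℝ × ℝ × ℝ → E3 := fun z => fderiv ℝ ψ z e₄
  have hψ₁ : ContDiffOn ℝ ∞ ψ₁ Φ.target :=
    (hψ.fderiv_of_isOpen Φ.open_target (by simp)).clm_apply contDiffOn_const
  let ψ₂ : ℝ × ℝ × ℝ × ℝ → E3 := fun z => fderiv ℝ ψ₁ z e₄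
  have hψ₂ : ContDiffOn ℝ ∞ ψ₂ Φ.target :=
    (hψ₁.fderiv_of_isOpen Φ.open_target (by simp)).clm_apply contDiffOn_const
  have hζd : ∀ (x a b t : ℝ), HasDerivAt (fun s : ℝ => (x, a, b, s)) e₄ t := fun x a b t =>
    (hasDerivAt_const t x).prodMk ((hasDerivAt_const t a).prodMk
      ((hasDerivAt_const t b).prodMk (hasDerivAt_id t)))
  have hcd : ∀ (x a b t : ℝ), (x, a, b, t) ∈ Φ.target →
      HasDerivAt (fun s => ψ (x, a, b, s)) (ψ₁ (x, a, b, t)) t := fun x a b t ht =>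
    HasFDerivAt.comp_hasDerivAt (l := ψ) (f := fun s : ℝ => (x, a, b, s)) t
      (((hψ.contDiffAt (Φ.open_target.mem_nhds ht)).differentiableAt (by simp)).hasFDerivAt)
      (hζd x a b t)
  have hcd₂ : ∀ (x a b t : ℝ), (x, a, b, t) ∈ Φ.target →
      HasDerivAt (fun s => ψ₁ (x, a, b, s)) (ψ₂ (x, a, b, t)) t := fun x a b t ht =>
    HasFDerivAt.comp_hasDerivAt (l := ψ₁) (f := fun s : ℝ => (x, a, b, s)) t
      (((hψ₁.contDiffAt (Φ.open_target.mem_nhds ht)).differentiableAt (by simp)).hasFDerivAt)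
      (hζd x a b t)
  have hψmem : ∀ z ∈ Φ.target, z.1 ∈ I ∧ ψ z ∈ M ∧ famJetMap f (z.1, ψ z) = z := by
    intro z hz
    have h1 : famJetMap f (Φ.symm z) = z := by rw [← hΦ, Φ.right_inv hz]
    have h2 : Φ.symm z = (z.1, ψ z) :=
      Prod.ext (show (Φ.symm z).1 = z.1 from congrArg Prod.fst h1) rfl
    have h3 := hΦsub (Φ.map_target hz)
    rw [h2] at h1 h3
    exact ⟨h3.1, h3.2, h1⟩
  have hψinv : ∀ z ∈ Φ.source, ψ (famJetMap f z) = z.2 := fun z hz => by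
    change (Φ.symm (famJetMap f z)).2 = z.2
    rw [← hΦ, Φ.left_inv hz]
  have hdir : ∀ (x a b t : ℝ), (x, a, b, t) ∈ Φ.target →
      famJetD f 0 (x, ψ (x, a, b, t)) (ψ₁ (x, a, b, t)) = 0 ∧
      famJetD f 1 (x, ψ (x, a, b, t)) (ψ₁ (x, a, b, t)) = 0 ∧
      famJetD f 2 (x, ψ (x, a, b, t)) (ψ₁ (x, a, b, t)) = 1 := by
    intro x a b t ht
    obtain ⟨hx, hR, -⟩ := hψmem _ ht
    have hd : ∀ k, HasDerivAt (fun s => famJet f k (x, ψ (x, a, b, s)))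
        (famJetD f k (x, ψ (x, a, b, t)) (ψ₁ (x, a, b, t))) t := by
      intro k
      have h1 := HasFDerivAt.comp_hasDerivAt (l := famJet f k)
        (f := fun s => (x, ψ (x, a, b, s))) t (hasFDerivAt_famJet hI hM hf k hx hR)
        ((hasDerivAt_const t x).prodMk (hcd x a b t ht))
      simpa [Function.comp_def] using h1
    have hev : ∀ᶠ s in 𝓝 t, famJetMap f (x, ψ (x, a, b, s)) = (x, a, b, s) := by
      filter_upwards [(hζd x a b t).continuousAt.eventually (Φ.open_target.mem_nhds ht)] with s hs
        using (hψmem _ hs).2.2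
    refine ⟨(hd 0).unique ((hasDerivAt_const t a).congr_of_eventuallyEq ?_),
      (hd 1).unique ((hasDerivAt_const t b).congr_of_eventuallyEq ?_),
      (hd 2).unique ((hasDerivAt_id t).congr_of_eventuallyEq ?_)⟩
    · filter_upwards [hev] with s hs using congrArg (fun z => z.2.1) hs
    · filter_upwards [hev] with s hs using congrArg (fun z => z.2.2.1) hs
    · filter_upwards [hev] with s hs using congrArg (fun z => z.2.2.2) hs
  set z₀ := famJetMap f (x₀, P₀) with hz₀
  have hz₀t : z₀ ∈ Φ.target := by
    rw [hz₀, ← hΦ]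
    exact Φ.map_source h0Φ
  have hψz₀ : ψ z₀ = P₀ := hψinv _ h0Φ
  -- `q` is half the second derivative of `‖ψ - P₀‖²` in the direction of the second-derivative
  -- coordinate; at `z₀` it equals `‖ψ₁ z₀‖²`.
  let q : ℝ × ℝ × ℝ × ℝ → ℝ := fun z => inner ℝ (ψ z - P₀) (ψ₂ z) + inner ℝ (ψ₁ z) (ψ₁ z)
  have hq : ContinuousOn q Φ.target :=
    ((hψ.continuousOn.sub continuousOn_const).inner hψ₂.continuousOn).add
      (hψ₁.continuousOn.inner hψ₁.continuousOn)
  have hqz₀ : 0 < q z₀ := by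
    have h1 : ψ₁ z₀ ≠ 0 := by
      intro h0
      have h2 := (hdir _ _ _ _ hz₀t).2.2
      change famJetD f 2 (x₀, ψ z₀) (ψ₁ z₀) = 1 at h2
      rw [h0, map_zero] at h2
      exact zero_ne_one h2
    simp only [q, hψz₀, sub_self, inner_zero_left, zero_add]
    exact real_inner_self_pos.2 h1
  obtain ⟨ρ, hρ, hρball⟩ : ∃ ρ > 0, ∀ z ∈ Metric.ball z₀ ρ, z ∈ Φ.target ∧ 0 < q z := by
    have h1 : ∀ᶠ z in 𝓝 z₀, 0 < q z :=
      (hq.continuousAt (Φ.open_target.mem_nhds hz₀t)).eventually (lt_mem_nhds hqz₀)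
    have h2 : ∀ᶠ z in 𝓝 z₀, z ∈ Φ.target := Φ.open_target.mem_nhds hz₀t
    obtain ⟨ρ, hρ, h⟩ := Metric.eventually_nhds_iff.1 (h2.and h1)
    exact ⟨ρ, hρ, fun z hz => h hz⟩
  have hev : ∀ᶠ z in 𝓝 (x₀, P₀), (z.1 ∈ I ∩ U ∧ z.2 ∈ M ∩ V) ∧ z ∈ Φ.source ∧
      famJetMap f z ∈ Metric.ball z₀ ρ ∧ z ∈ Metric.ball (x₀, P₀) δ₁ := by
    have h1 : ∀ᶠ z in 𝓝 (x₀, P₀), z.1 ∈ I ∩ U ∧ z.2 ∈ M ∩ V :=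
      prod_mem_nhds (Filter.inter_mem (hI.mem_nhds hx₀) hU)
        (Filter.inter_mem (hM.mem_nhds hP₀) hV)
    have h2 : ∀ᶠ z in 𝓝 (x₀, P₀), z ∈ Φ.source := Φ.open_source.mem_nhds h0Φ
    have h3 : ∀ᶠ z in 𝓝 (x₀, P₀), famJetMap f z ∈ Metric.ball z₀ ρ := by
      have h4 : ContinuousAt Φ (x₀, P₀) := Φ.continuousAt h0Φ
      have h5 := h4.eventually (p := fun z => z ∈ Metric.ball z₀ ρ)
        (by rw [hΦ]; exact Metric.ball_mem_nhds _ hρ)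
      simpa only [hΦ] using h5
    exact h1.and (h2.and (h3.and (Metric.ball_mem_nhds _ hδ₁)))
  obtain ⟨δ, hδ, hδball⟩ := Metric.eventually_nhds_iff.1 hev
  have hmem : ∀ x ∈ Ioo (x₀ - δ) (x₀ + δ), ∀ P ∈ Metric.ball P₀ δ,
      (x ∈ I ∩ U ∧ P ∈ M ∩ V) ∧ (x, P) ∈ Φ.source ∧
      famJetMap f (x, P) ∈ Metric.ball z₀ ρ ∧ (x, P) ∈ Metric.ball (x₀, P₀) δ₁ := by
    intro x hx P hP
    refine hδball (y := (x, P)) ?_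
    rw [Prod.dist_eq, Real.dist_eq]
    refine max_lt (abs_lt.2 ⟨?_, ?_⟩) hP
    · linarith [hx.1]
    · linarith [hx.2]
  have hx₀J : x₀ ∈ Ioo (x₀ - δ) (x₀ + δ) := ⟨by linarith, by linarith⟩
  have hP₀W : P₀ ∈ Metric.ball P₀ δ := Metric.mem_ball_self hδ
  have hJI : Ioo (x₀ - δ) (x₀ + δ) ⊆ I ∩ U := fun x hx => (hmem x hx P₀ hP₀W).1.1
  have hWM : Metric.ball P₀ δ ⊆ M ∩ V := fun P hP => (hmem x₀ hx₀J P hP).1.2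
  refine ⟨Ioo (x₀ - δ) (x₀ + δ), Metric.ball P₀ δ, hx₀J, hJI, hP₀W, hWM,
    .ioo (by linarith), Metric.isOpen_ball, convex_ball _ _,
    hf.mono (prod_mono (hJI.trans inter_subset_left) (hWM.trans inter_subset_left)),
    fun a ha b hb c hc => hnd a (hmem _ ha.1 _ ha.2).2.2.2 b (hmem _ hb.1 _ hb.2).2.2.2 c
      (hmem _ hc.1 _ hc.2).2.2.2, ?_, ?_⟩
  · intro x hx P hP
    set a := famJet f 0 (x, P) with ha
    set b := famJet f 1 (x, P) with hb
    -- In the sup metric the ball about `z₀` is a product, so with the other coordinates fixed the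
    -- last one ranges over the full interval `T₀`.
    let T₀ : Set ℝ := Metric.ball z₀.2.2.2 ρ
    have hζ : ∀ t ∈ T₀, (x, a, b, t) ∈ Metric.ball z₀ ρ := by
      intro t ht
      have h1 := (hmem x hx P hP).2.2.1
      simp only [famJetMap, Metric.mem_ball, Prod.dist_eq, max_lt_iff] at h1 ⊢
      exact ⟨h1.1, h1.2.1, h1.2.2.1, ht⟩
    have hζt : ∀ t ∈ T₀, (x, a, b, t) ∈ Φ.target := fun t ht => (hρball _ (hζ t ht)).1
    let c : ℝ → E3 := fun t => ψ (x, a, b, t)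
    have hc : ContDiffOn ℝ ∞ c T₀ :=
      hψ.comp (contDiff_const.prodMk (contDiff_const.prodMk
        (contDiff_const.prodMk contDiff_id))).contDiffOn hζt
    have hnorm : ∀ t ∈ T₀, HasDerivAt (fun s => ‖c s - P₀‖ ^ 2)
        (2 * inner ℝ (c t - P₀) (ψ₁ (x, a, b, t))) t := fun t ht =>
      ((hcd x a b t (hζt t ht)).sub_const P₀).norm_sq
    have hnorm₂ : ∀ t ∈ T₀, HasDerivAt (fun s => 2 * inner ℝ (c s - P₀) (ψ₁ (x, a, b, s)))
        (2 * q (x, a, b, t)) t := fun t ht =>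
      (((hcd x a b t (hζt t ht)).sub_const P₀).inner ℝ (hcd₂ x a b t (hζt t ht))).const_mul 2
    have hint : interior T₀ = T₀ := Metric.isOpen_ball.interior_eq
    have hconv : ConvexOn ℝ T₀ fun s => ‖c s - P₀‖ ^ 2 := by
      refine convexOn_of_hasDerivWithinAt2_nonneg (convex_ball _ _)
        (fun t ht => (hnorm t ht).continuousAt.continuousWithinAt)
        (f' := fun t => 2 * inner ℝ (c t - P₀) (ψ₁ (x, a, b, t)))
        (f'' := fun t => 2 * q (x, a, b, t)) ?_ ?_ ?_
      all_goals
        rw [hint]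
        intro t ht
      · exact (hnorm t ht).hasDerivWithinAt
      · exact (hnorm₂ t ht).hasDerivWithinAt
      · exact mul_nonneg zero_le_two (hρball _ (hζ t ht)).2.le
    have hball : ∀ R : E3, ‖R - P₀‖ ^ 2 < δ ^ 2 ↔ R ∈ Metric.ball P₀ δ := by
      intro R
      rw [mem_ball_iff_norm]
      exact sq_lt_sq₀ (norm_nonneg _) hδ.le
    have hback : ∀ R ∈ Metric.ball P₀ δ, IncidentAt f x P R →
        famJet f 2 (x, R) ∈ T₀ ∧ c (famJet f 2 (x, R)) = R := by
      intro R hR hi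
      obtain ⟨e₀, e₁⟩ := incidentAt_iff_famJet.1 hi
      have h1 : famJetMap f (x, R) = (x, a, b, famJet f 2 (x, R)) := by
        rw [famJetMap, ← e₀, ← e₁]
      obtain ⟨-, h2, h3, -⟩ := hmem x hx R hR
      have h4 := hψinv _ h2
      rw [h1] at h3 h4
      simp only [Metric.mem_ball, Prod.dist_eq, max_lt_iff] at h3
      exact ⟨h3.2.2.2, h4⟩
    have hPb := hback P hP ⟨rfl, rfl⟩
    -- The parameters for which the curve stays in the ball form a sublevel set of a convex
    -- function, hence an interval.
    refine ⟨{t ∈ T₀ | ‖c t - P₀‖ ^ 2 < δ ^ 2}, c, ⟨?_, (hconv.convex_lt _).ordConnected, ?_⟩,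
      hc.mono fun t ht => ht.1, ?_, fun t ht => ?_⟩
    · exact ContinuousOn.isOpen_inter_preimage (t := Iio (δ ^ 2))
        (fun t ht => (hnorm t ht).continuousAt.continuousWithinAt) Metric.isOpen_ball isOpen_Iio
    · refine ⟨_, hPb.1, ?_⟩
      rw [hPb.2, hball]
      exact hP
    · ext R
      constructor
      · rintro ⟨t, ⟨ht, htR⟩, rfl⟩
        have h1 := (hψmem _ (hζt t ht)).2.2
        simp only [famJetMap, Prod.mk.injEq] at h1
        exact ⟨(hball _).1 htR, incidentAt_iff_famJet.2 ⟨h1.2.1.symm, h1.2.2.1.symm⟩⟩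
      · rintro ⟨hR, hi⟩
        obtain ⟨h1, h2⟩ := hback R hR hi
        refine ⟨_, ⟨h1, ?_⟩, h2⟩
        rw [h2, hball]
        exact hR
    · exact congrArg (fun z => z.2.2.2) (hψmem _ (hζt t ht.1)).2.2
  · intro P hP
    have hmaps : ∀ x ∈ Ioo (x₀ - δ) (x₀ + δ), famJetMap f (x, P) ∈ Φ.target := fun x hx =>
      (hρball _ (hmem x hx P hP).2.2.1).1
    -- The direction at `x` is the velocity, in the second-derivative coordinate, of the inverse jet
    -- map at the jet of `P`.
    refine ⟨fun x => ψ₁ (famJetMap f (x, P)), ?_, fun x hx => ?_⟩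
    · refine hψ₁.comp ?_ hmaps
      have hj : ∀ k, ContDiffOn ℝ ∞ (fun x => famJet f k (x, P)) (Ioo (x₀ - δ) (x₀ + δ)) :=
        fun k => (contDiffOn_famJet hI hM hf k).comp
          (contDiff_id.prodMk contDiff_const).contDiffOn
          fun x hx => ⟨(hJI hx).1, (hWM hP).1⟩
      exact contDiffOn_id.prodMk ((hj 0).prodMk ((hj 1).prodMk (hj 2)))
    · have h1 := hdir _ _ _ _ (hmaps x hx)
      have h2 := hψinv _ (hmem x hx P hP).2.1
      change famJetD f 0 (x, ψ (famJetMap f (x, P))) (ψ₁ (famJetMap f (x, P))) = 0 ∧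
        famJetD f 1 (x, ψ (famJetMap f (x, P))) (ψ₁ (famJetMap f (x, P))) = 0 ∧
        famJetD f 2 (x, ψ (famJetMap f (x, P))) (ψ₁ (famJetMap f (x, P))) = 1 at h1
      rwa [h2] at h1

end Existence
theorem mainTheorem4 (D : Set (ℝ × ℝ × ℝ × ℝ)) (hD : IsOpen D)
    (F : ℝ × ℝ × ℝ × ℝ → ℝ) (hF : ContDiffOn ℝ ∞ F D) :
    -- the equation has, locally, a regular solution space, parametrized by initial data
    (∀ (x₀ : ℝ) (P₀ : E3), (x₀, P₀ 0, P₀ 1, P₀ 2) ∈ D →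
      ∃ (I : Set ℝ) (M : Set E3) (f : ℝ → E3 → ℝ), x₀ ∈ I ∧ P₀ ∈ M ∧
        IsRegularSolutionSpace D F I M f ∧
        (∀ P ∈ M, jetTwo (fun x => f x P) x₀ = (x₀, P 0, P 1, P 2)) ∧
        (∀ P ∈ M, ∀ y : ℝ → ℝ, IsSolutionOn D F I y → jetTwo y x₀ = (x₀, P 0, P 1, P 2) →
          ∀ x ∈ I, y x = f x P)) ∧
    -- on every regular solution space, incidence is locally a causal geometry
    (∀ (I : Set ℝ) (M : Set E3) (f : ℝ → E3 → ℝ), IsRegularSolutionSpace D F I M f →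
      ∀ x₀ ∈ I, ∀ P₀ ∈ M, ∀ U ∈ 𝓝 x₀, ∀ V ∈ 𝓝 P₀,
        ∃ (J : Set ℝ) (W : Set E3), IsOpenInterval J ∧ x₀ ∈ J ∧ J ⊆ I ∩ U ∧
          IsOpen W ∧ P₀ ∈ W ∧ W ⊆ M ∩ V ∧
          (∀ P ∈ W, ∀ Q ∈ W, P ≠ Q → ∀ x ∈ J, ∀ x' ∈ J,
            IncidentAt f x P Q → IncidentAt f x' P Q → x = x') ∧
          IsCausalGeometry W (incidenceCone J W f) (incidenceCurve J W f)) := by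
  refine ⟨fun x₀ P₀ h₀ => exists_regularSolutionSpace hD hF h₀, ?_⟩
  intro I M f hS x₀ hx₀ P₀ hP₀ U hU V hV
  obtain ⟨J, W, hxJ, hJ, hPW, hW, h⟩ := exists_isIncidenceNbhd hS.isOpenInterval.1 hS.isOpen
    hS.smooth hx₀ hP₀ (hS.wronskian_ne_zero x₀ hx₀ P₀ hP₀) hU hV
  exact ⟨J, W, h.isOpenInterval, hxJ, hJ, h.isOpen, hPW, hW,
    fun P hP Q hQ hPQ x hx x' hx' hi hi' => h.incidentAt_unique hP hQ hx hx' hPQ hi hi',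
    h.isCausalGeometry⟩
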